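/- Let $K$ be an arbitrary field. For a finite separable extension $L/L_0$ of fields containing $K$, say that $L/L_0$ is *defined over* an intermediate field $K\subseteq E_0\subseteq L_0$ if there is a field $E$ with $E_0\subseteq E\subseteq L$, $[E:E_0]=[L:L_0]$ and $L=EL_0$; let $\mathrm{ed}_K(L/L_0)$ be the minimum of $\operatorname{trdeg}_K E_0$ over all such $E_0$. For a finite group $G$, the essential dimension $\mathrm{ed}_K(G)$ is $\mathrm{ed}_K(K(V)/K(V)^G)$, where $G\to GL(V)$ is any faithful finite-dimensional representation of $G$ over $K$ and $K(V)$ is the function field of the affine space $V$; this value does not depend on the choice of $V$. Let $S_n$ be the symmetric group on $n$ letters. **Theorem.** For every field $K$: 1. if $n\ge 5$, then $\mathrm{ed}_K(S_n)\le n-3$; 2. $\mathrm{ed}_K(S_2)=\mathrm{ed}_K(S_3)=1$ and $\mathrm{ed}_K(S_4)=\mathrm{ed}_K(S_5)=2$; 3. if $\operatorname{char}K\ne 2$, then $\mathrm{ed}_K(S_6)=3$. (Each assertion is understood to hold for $\mathrm{ed}_K(K(V)/K(V)^{S_n})$ with every faithful finite-dimensional representation $V$ of $S_n$, with a value independent of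 $V$.) -/

import Mathlib

noncomputable section

namespace EssentialDimension

universe u v

section Extensions

variable {K : Type u} {L : Type v} [Field K] [Field L] [Algebra K L]

/-- Let `L/L₀` be a finite separable extension of fields containing `K`. It is *defined over*
the intermediate field `E₀` of `L₀/K` if there is a field `E` with `E₀ ⊆ E ⊆ L` such that
`[E : E₀] = [L : L₀]` and `L = E L₀`. -/
def IsDefinedOver (L₀ E₀ : IntermediateField K L) : Prop :=
  E₀ ≤ L₀ ∧ ∃ E : IntermediateField K L, E₀ ≤ E ∧
    IntermediateField.relfinrank E₀ E = Module.finrank L₀ L ∧ E ⊔ L₀ = ⊤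

/-- The essential dimension `ed_K(L/L₀)` of a finite separable extension `L/L₀` of fields
containing `K`: the minimum of `trdeg_K E₀` over all `E₀` over which `L/L₀` is defined. The set is
never empty for a finite extension (take `E₀ = L₀`), and cardinals are well-ordered, so this
infimum is attained. -/
def edExt (L₀ : IntermediateField K L) : Cardinal.{v} :=
  sInf {t | ∃ E₀ : IntermediateField K L, IsDefinedOver L₀ E₀ ∧ t = Algebra.trdeg K E₀}

end Extensions

section Representations

variable {K : Type u} [Field K] {m : ℕ}

/-- The pull-back of polynomial functions on `V = K^m` along `g⁻¹`: the `K`-algebra endomorphism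
of `K[x₁, …, x_m]` with `(g f)(v) = f(g⁻¹ v)`, that is `g x_i = ∑_j (g⁻¹)_{ij} x_j`. -/
def polyMap (g : GL (Fin m) K) : MvPolynomial (Fin m) K →ₐ[K] MvPolynomial (Fin m) K :=
  MvPolynomial.aeval fun i =>
    ∑ j, ((g⁻¹ : GL (Fin m) K) : Matrix (Fin m) (Fin m) K) i j • MvPolynomial.X j

theorem polyMap_one :
    polyMap (1 : GL (Fin m) K) = AlgHom.id K (MvPolynomial (Fin m) K) := by
  apply MvPolynomial.algHom_ext
  intro i
  simp [polyMap, Matrix.one_apply]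

theorem polyMap_mul (g h : GL (Fin m) K) :
    polyMap (g * h) = (polyMap g).comp (polyMap h) := by
  apply MvPolynomial.algHom_ext
  intro i
  simp only [polyMap, mul_inv_rev, Units.val_mul, Matrix.mul_apply, MvPolynomial.aeval_X,
    AlgHom.comp_apply, map_sum, map_smul, Finset.sum_smul, Finset.smul_sum, smul_smul]
  rw [Finset.sum_comm]

/-- The action of `GL_m(K)` on the polynomial ring `K[x₁, …, x_m]` by `K`-algebra
automorphisms. -/
def polyAction : GL (Fin m) K →* (MvPolynomial (Fin m) K ≃ₐ[K] MvPolynomial (Fin m) K) where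
  toFun g := AlgEquiv.ofAlgHom (polyMap g) (polyMap g⁻¹)
    (by rw [← polyMap_mul, mul_inv_cancel, polyMap_one])
    (by rw [← polyMap_mul, inv_mul_cancel, polyMap_one])
  map_one' := by
    ext1 x
    exact congrArg (fun f => f x) (polyMap_one (K := K) (m := m))
  map_mul' g h := by
    ext1 x
    exact congrArg (fun f => f x) (polyMap_mul g h)

variable (K m) in
/-- The function field `K(V) = K(x₁, …, x_m)` of the affine space `V = K^m`. -/
abbrev FunctionField : Type u := FractionRing (MvPolynomial (Fin m) K)

/-- The action of `G` on `K(V)` by `K`-automorphisms induced by a representation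
`ρ : G → GL(V)`, `V = K^m`. -/
def functionFieldAction {G : Type v} [Group G] (ρ : G →* GL (Fin m) K) :
    G →* (FunctionField K m ≃ₐ[K] FunctionField K m) :=
  (IsFractionRing.fieldEquivOfAlgEquivHom K (FunctionField K m)).comp
    (polyAction.comp ρ)

/-- The field of invariants `K(V)^G`. -/
def invariantField {G : Type v} [Group G] (ρ : G →* GL (Fin m) K) :
    IntermediateField K (FunctionField K m) :=
  IntermediateField.fixedField (functionFieldAction ρ).range

end Representations

/-- `ed_K(G) = d`: the group `G` has a faithful finite-dimensional representation over `K`, and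
`ed_K(K(V)/K(V)^G) = d` for every faithful finite-dimensional representation `G → GL(V)`. -/
def IsEssDim (K : Type u) [Field K] (G : Type v) [Group G] (d : ℕ) : Prop :=
  (∃ (m : ℕ) (ρ : G →* GL (Fin m) K), Function.Injective ρ) ∧
    ∀ (m : ℕ) (ρ : G →* GL (Fin m) K), Function.Injective ρ →
      edExt (invariantField ρ) = (d : Cardinal)

end EssentialDimension

end

/-! Artin's theorem turns the definition into a statement about group actions: `ed_K(L/L^G)` is the
least transcendence degree of a compression, i.e. a `G`-stable subfield of `L` on which `G` still
acts faithfully (`edExt_le_iff`, `le_edExt_iff`).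

The engine is versality (`IsCompression.specialize`): a compression of `K(V)` is described by
finitely many rational functions on `V`, and these can be evaluated at a `G`-equivariant `L`-point
of `V`, for any infinite faithful `G`-field `L`. Such points are Zariski dense, so denominators and
faithfulness survive, and the transcendence degree cannot grow. With `L = K(V')` this gives
independence of `V`; with other `L` it gives lower bounds.

Upper bounds come from the permutation representation. The ratios, difference ratios and
cross-ratios of the coordinates generate stable subfields of transcendence degree at most `n-1`,
`n-2`, `n-3`, on which `S_n` acts faithfully for `n ≥ 2`, `n ≥ 3`, `n ≥ 5` respectively.

Lower bounds away from characteristic two: `S_n` contains `(ℤ/2)^r` if `2r ≤ n`, and this group acts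
by signs on iterated Laurent series in `r` variables. A compression there contains `r` series whose
orders are independent modulo two, hence `r` algebraically independent elements. In characteristic
two, a compression of transcendence degree at most one can be shrunk to one inside `K(X)`, which by
Lüroth is itself `K(X)`; but `PGL_2(K)` then has no element of order four, while `S_4` has. The same
embedding in `K(X)` excludes transcendence degree zero over every field. -/

noncomputable section

namespace EssentialDimension

universe u v w

open Cardinal

/-! ### Compressions and essential dimension. -/

section Compression

variable {K : Type u} {L : Type v} [Field K] [Field L] [Algebra K L] {G : Type w} [Group G]

theorem trdeg_eq_of_isAlgebraic (K : Type u) (S A : Type v) [Field K] [CommRing S] [Field A]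
    [Algebra K S] [Algebra K A] [Algebra S A] [IsScalarTower K S A] [FaithfulSMul S A]
    [FaithfulSMul K S] [Algebra.IsAlgebraic S A] : Algebra.trdeg K A = Algebra.trdeg K S := by
  have h2 := trdeg_add_eq K S (A := A)
  rwa [trdeg_eq_zero (R := S), add_zero, eq_comm] at h2

theorem trdeg_le_of_forall_isAlgebraic {E F : IntermediateField K L}
    (h : ∀ x ∈ E, IsAlgebraic F x) : Algebra.trdeg K E ≤ Algebra.trdeg K F := by
  have hle : E ≤ (algebraicClosure F L).restrictScalars K := fun x hx =>
    mem_algebraicClosure_iff.mpr (h x hx)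
  have h1 := trdeg_le_of_injective (IntermediateField.inclusion hle)
    (IntermediateField.inclusion_injective hle)
  let M : IntermediateField F L := algebraicClosure F L
  have : FaithfulSMul F M :=
    (faithfulSMul_iff_algebraMap_injective _ _).mpr (algebraMap F M).injective
  have : FaithfulSMul K F :=
    (faithfulSMul_iff_algebraMap_injective _ _).mpr (algebraMap K F).injective
  exact h1.trans (trdeg_eq_of_isAlgebraic K F M).le

theorem trdeg_le_of_le {E F : IntermediateField K L} (h : E ≤ F) :
    Algebra.trdeg K E ≤ Algebra.trdeg K F :=
  trdeg_le_of_injective (IntermediateField.inclusion h) (IntermediateField.inclusion_injective h)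

/-- An intermediate field on which `G` acts faithfully: a compression of the `G`-field `L`. -/
structure IsCompression (α : G →* (L ≃ₐ[K] L)) (E : IntermediateField K L) : Prop where
  map_mem : ∀ g, ∀ x ∈ E, α g x ∈ E
  faithful : ∀ g, g ≠ 1 → ∃ x ∈ E, α g x ≠ x

variable {α : G →* (L ≃ₐ[K] L)}

theorem mem_fixedField_range {x : L} :
    x ∈ IntermediateField.fixedField α.range ↔ ∀ g, α g x = x := by
  rw [IntermediateField.mem_fixedField_iff]
  simp

/-- Artin's theorem for the faithful action of `G` on `E`, whose fixed field is `E ∩ L^G`. -/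
theorem IsCompression.relfinrank_eq [Finite G] {E : IntermediateField K L}
    (hE : IsCompression α E) :
    IntermediateField.relfinrank (E ⊓ IntermediateField.fixedField α.range) E = Nat.card G := by
  let _ : MulSemiringAction G L := MulSemiringAction.compHom L α
  have hsm : ∀ (g : G) (x : L), g • x = α g x := fun _ _ => rfl
  have : IsInvariantSubfield G E.toSubfield := ⟨fun g {x} hx => hE.map_mem g x hx⟩
  have : FaithfulSMul G E.toSubfield := by
    refine ⟨fun {g h} hgh => ?_⟩
    by_contra hne
    obtain ⟨x, hx, hx'⟩ := hE.faithful (h⁻¹ * g) (fun h1 => hne (inv_mul_eq_one.mp h1).symm)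
    apply hx'
    have := congrArg Subtype.val (hgh ⟨x, hx⟩)
    change α g x = α h x at this
    rw [map_mul, AlgEquiv.mul_apply, this, ← AlgEquiv.mul_apply, ← map_mul]
    simp
  have hfix : (E ⊓ IntermediateField.fixedField α.range).toSubfield.comap E.toSubfield.subtype
      = FixedPoints.subfield G E.toSubfield := by
    ext x
    have : x ∈ FixedPoints.subfield G E.toSubfield ↔ ∀ g : G, g • x = x := Iff.rfl
    rw [this, Subfield.mem_comap]
    change ((x : L) ∈ E ∧ (x : L) ∈ IntermediateField.fixedField α.range) ↔ _
    rw [mem_fixedField_range]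
    constructor
    · exact fun h g => Subtype.ext (h.2 g)
    · exact fun h => ⟨x.2, fun g => congrArg Subtype.val (h g)⟩
  have := Fintype.ofFinite G
  have h1 := FixedPoints.finrank_eq_card G E.toSubfield
  rw [← hfix, Subfield.finrank_comap, Subfield.fieldRange_subtype] at h1
  rw [Nat.card_eq_fintype_card]
  exact h1

theorem IsCompression.mono {E F : IntermediateField K L} (hE : IsCompression α E) (h : E ≤ F)
    (hF : ∀ g, ∀ x ∈ F, α g x ∈ F) : IsCompression α F :=
  ⟨hF, fun g hg => let ⟨x, hx, hx'⟩ := hE.faithful g hg; ⟨x, h hx, hx'⟩⟩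

theorem isCompression_top (hα : Function.Injective α) : IsCompression α ⊤ := by
  refine ⟨fun _ _ _ => trivial, fun g hg => ?_⟩
  by_contra! h
  refine hg (hα ?_)
  ext x
  simpa using h x trivial

theorem map_mem_iff_map_le {E : IntermediateField K L} {f : L ≃ₐ[K] L} :
    (∀ x ∈ E, f x ∈ E) ↔ E.map (f : L →ₐ[K] L) ≤ E := by
  rw [IntermediateField.map_le_iff_le_comap]
  rfl

theorem finrank_fixedField_range [Finite G] (hα : Function.Injective α) :
    Module.finrank (IntermediateField.fixedField α.range) L = Nat.card G := by
  have := (isCompression_top hα).relfinrank_eq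
  rwa [top_inf_eq, IntermediateField.relfinrank_top_right] at this

/-- The composite `E L^G` is again a compression, so it has degree `|G|` over `L^G` and must be all
of `L`. -/
theorem IsCompression.isDefinedOver [Finite G] {E : IntermediateField K L}
    (hE : IsCompression α E) (hα : Function.Injective α) :
    IsDefinedOver (IntermediateField.fixedField α.range)
      (E ⊓ IntermediateField.fixedField α.range) := by
  refine ⟨inf_le_right, E, inf_le_left, ?_, ?_⟩
  · rw [hE.relfinrank_eq, finrank_fixedField_range hα]
  · set L₀ := IntermediateField.fixedField α.range
    have hM : IsCompression α (E ⊔ L₀) := by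
      refine hE.mono le_sup_left fun g => ?_
      rw [map_mem_iff_map_le, IntermediateField.map_sup]
      refine sup_le_sup (map_mem_iff_map_le.mp (hE.map_mem g)) (map_mem_iff_map_le.mp fun x hx => ?_)
      rwa [mem_fixedField_range.mp hx g]
    have h1 := hM.relfinrank_eq
    change IntermediateField.relfinrank ((E ⊔ L₀) ⊓ L₀) _ = _ at h1
    rw [inf_eq_right.mpr le_sup_right] at h1
    have h2 := IntermediateField.relfinrank_mul_finrank_top (le_sup_right : L₀ ≤ E ⊔ L₀)
    rw [h1, finrank_fixedField_range hα] at h2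
    have h3 := (mul_eq_left₀ Nat.card_pos.ne').mp h2
    rwa [IntermediateField.finrank_eq_one_iff_eq_top] at h3

/-- The field `E` in the definition need not be stable. The composite of its conjugates is, and it
remains algebraic over `E₀`, which `G` fixes pointwise. It is faithful because an element fixing `E`
and `L^G` fixes `E L^G = L`. -/
theorem exists_isCompression_of_isDefinedOver [Finite G] (hα : Function.Injective α)
    {E₀ : IntermediateField K L}
    (h : IsDefinedOver (IntermediateField.fixedField α.range) E₀) :
    ∃ E, IsCompression α E ∧ Algebra.trdeg K E ≤ Algebra.trdeg K E₀ := by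
  obtain ⟨h0, E, hE0, hrel, htop⟩ := h
  have halg : ∀ x ∈ E, IsAlgebraic E₀ x := by
    intro x hx
    rw [IntermediateField.relfinrank_eq_finrank_of_le hE0, finrank_fixedField_range hα] at hrel
    have : FiniteDimensional E₀ (IntermediateField.extendScalars hE0) :=
      Module.finite_of_finrank_pos (hrel ▸ Nat.card_pos)
    have h1 := Algebra.IsAlgebraic.isAlgebraic (R := E₀)
      (⟨x, hx⟩ : IntermediateField.extendScalars hE0)
    exact h1.algebraMap (A := L)
  refine ⟨⨆ g, E.map (α g : L →ₐ[K] L), ⟨fun g => ?_, fun g hg => ?_⟩, ?_⟩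
  · rw [map_mem_iff_map_le, IntermediateField.map_iSup]
    refine iSup_le fun h => ?_
    rw [IntermediateField.map_map]
    refine le_trans (le_of_eq ?_) (le_iSup _ (g * h))
    congr 1
    rw [map_mul]
    rfl
  · by_contra! hfix
    refine hg (hα ?_)
    rw [map_one]
    have hle : E ⊔ IntermediateField.fixedField α.range ≤
        IntermediateField.fixedField (Subgroup.zpowers (α g)) := by
      refine sup_le (fun x hx => ?_) (fun x hx => ?_) <;>
        rw [IntermediateField.mem_fixedField_iff]
      · have h1 : α g x = x := by
          refine hfix x ?_
          refine (le_iSup (fun g => E.map (α g : L →ₐ[K] L)) 1) ?_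
          exact ⟨x, hx, by simp⟩
        intro f hf
        have : Subgroup.zpowers (α g) ≤ MulAction.stabilizer (L ≃ₐ[K] L) x := by
          rw [Subgroup.zpowers_le]; exact h1
        exact this hf
      · have h1 : α g x = x := mem_fixedField_range.mp hx g
        intro f hf
        have : Subgroup.zpowers (α g) ≤ MulAction.stabilizer (L ≃ₐ[K] L) x := by
          rw [Subgroup.zpowers_le]; exact h1
        exact this hf
    ext x
    have hx : x ∈ E ⊔ IntermediateField.fixedField α.range := htop ▸ trivial
    exact (IntermediateField.mem_fixedField_iff _ _).mp (hle hx) _ (Subgroup.mem_zpowers _)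
  · refine trdeg_le_of_forall_isAlgebraic ?_
    have : (⨆ g, E.map (α g : L →ₐ[K] L)) ≤ (algebraicClosure E₀ L).restrictScalars K := by
      refine iSup_le fun g => ?_
      rintro _ ⟨x, hx, rfl⟩
      -- Since `E₀ ⊆ L^G`, each `α g` is `E₀`-linear and preserves algebraicity over `E₀`.
      let f : L →ₐ[E₀] L :=
        { (α g : L →+* L) with
          commutes' := fun r => mem_fixedField_range.mp (h0 r.2) g }
      exact mem_algebraicClosure_iff.mpr ((halg x hx).algHom f)
    exact fun x hx => mem_algebraicClosure_iff.mp (this hx)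

theorem edExt_le_iff [Finite G] (hα : Function.Injective α) {t : Cardinal.{v}} :
    edExt (IntermediateField.fixedField α.range) ≤ t ↔
      ∃ E, IsCompression α E ∧ Algebra.trdeg K E ≤ t := by
  constructor
  · intro h
    obtain ⟨E₀, hE₀, ht⟩ := csInf_mem
      (s := {t | ∃ E₀ : IntermediateField K L,
        IsDefinedOver (IntermediateField.fixedField α.range) E₀ ∧ t = Algebra.trdeg K E₀})
      ⟨_, _, (isCompression_top hα).isDefinedOver hα, rfl⟩
    obtain ⟨E, hE, hle⟩ := exists_isCompression_of_isDefinedOver hα hE₀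
    exact ⟨E, hE, hle.trans (ht.ge.trans h)⟩
  · rintro ⟨E, hE, hle⟩
    refine le_trans (csInf_le' ⟨_, hE.isDefinedOver hα, rfl⟩) ((trdeg_le_of_le inf_le_left).trans hle)

theorem le_edExt_iff [Finite G] (hα : Function.Injective α) {t : Cardinal.{v}} :
    t ≤ edExt (IntermediateField.fixedField α.range) ↔
      ∀ E, IsCompression α E → t ≤ Algebra.trdeg K E := by
  constructor
  · exact fun h E hE => h.trans ((edExt_le_iff hα).mpr ⟨E, hE, le_rfl⟩)
  · intro h
    obtain ⟨E, hE, hle⟩ := (edExt_le_iff hα).mp le_rfl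
    exact (h E hE).trans hle

end Compression

/-! ### Compressions generated by stable families. -/

section Generators

variable {K : Type u} {L : Type v} [Field K] [Field L] [Algebra K L] {G : Type w} [Group G]
  {α : G →* (L ≃ₐ[K] L)}

/-- Every compression contains an equivariant family indexed by `G × G` (with `G` acting on the
first factor) that separates the elements of `G`. -/
theorem IsCompression.exists_family {E : IntermediateField K L} (hE : IsCompression α E) :
    ∃ f : G × G → L, (∀ i, f i ∈ E) ∧ (∀ g h k, α g (f (h, k)) = f (g * h, k)) ∧
      ∀ g, g ≠ 1 → f (g, g) ≠ f (1, g) := by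
  choose! a ha ha' using hE.faithful
  -- For `k ≠ 1` the family at `(·, k)` is the orbit of some `a k ∈ E` moved by `k`. At `k = 1` the
  -- chosen `a` is arbitrary and may lie outside `E`, hence the value `0`.
  refine ⟨fun p => open scoped Classical in if p.2 = 1 then 0 else α p.1 (a p.2), ?_, ?_, ?_⟩
  · intro p
    dsimp only
    split_ifs with h
    · exact zero_mem _
    · exact hE.map_mem _ _ (ha _ h)
  · intro g h k
    dsimp only
    split_ifs
    · exact map_zero _
    · rw [map_mul, AlgEquiv.mul_apply]
  · intro g hg
    simpa [hg] using ha' g hg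

theorem isCompression_adjoin_range {ι : Type*} {f : ι → L}
    (hf : ∀ g i, α g (f i) ∈ Set.range f) (hf' : ∀ g, g ≠ 1 → ∃ i, α g (f i) ≠ f i) :
    IsCompression α (IntermediateField.adjoin K (Set.range f)) := by
  refine ⟨fun g => ?_, fun g hg => ?_⟩
  · rw [map_mem_iff_map_le, IntermediateField.adjoin_map]
    refine IntermediateField.adjoin.mono _ _ _ ?_
    rintro _ ⟨_, ⟨i, rfl⟩, rfl⟩
    exact hf g i
  · obtain ⟨i, hi⟩ := hf' g hg
    exact ⟨f i, IntermediateField.subset_adjoin _ _ ⟨i, rfl⟩, hi⟩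

theorem isCompression_adjoin_family {f : G × G → L}
    (hf : ∀ g h k, α g (f (h, k)) = f (g * h, k)) (hf' : ∀ g, g ≠ 1 → f (g, g) ≠ f (1, g)) :
    IsCompression α (IntermediateField.adjoin K (Set.range f)) :=
  isCompression_adjoin_range (fun g i => ⟨_, (hf g i.1 i.2).symm⟩)
    fun g hg => ⟨(1, g), by rw [hf, mul_one]; exact hf' g hg⟩

end Generators

/-! ### Transcendence degree under specialization. -/

section Trdeg

variable {K : Type u} [Field K]

open scoped IntermediateField.algebraAdjoinAdjoin in
theorem trdeg_adjoin {L : Type v} [Field L] [Algebra K L] (s : Set L) :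
    Algebra.trdeg K (IntermediateField.adjoin K s) = Algebra.trdeg K (Algebra.adjoin K s) := by
  exact trdeg_eq_of_isAlgebraic K (Algebra.adjoin K s) (IntermediateField.adjoin K s)

/-- The transcendence degree does not increase under specialization. -/
theorem trdeg_adjoin_range_le {A : Type w} {L L' : Type v} [CommRing A] [Algebra K A] [Field L]
    [Algebra K L] [Field L'] [Algebra K L'] {ι : Type*} (r : ι → A) (ψ : A →ₐ[K] L)
    (hψ : Function.Injective ψ) (φ : A →ₐ[K] L') :
    Algebra.trdeg K (IntermediateField.adjoin K (Set.range (φ ∘ r))) ≤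
      Algebra.trdeg K (IntermediateField.adjoin K (Set.range (ψ ∘ r))) := by
  rw [trdeg_adjoin, trdeg_adjoin, Set.range_comp, Set.range_comp, ← AlgHom.map_adjoin,
    ← AlgHom.map_adjoin]
  set R := Algebra.adjoin K (Set.range r)
  -- Injectivity of `ψ` identifies `K[ψ ∘ r]` with `K[r]`, so `K[φ ∘ r]` is a quotient of it.
  let e : R ≃ₐ[K] R.map ψ := R.equivMapOfInjective ψ hψ
  let f : R →ₐ[K] R.map φ := (φ.comp R.val).codRestrict (R.map φ) fun x => ⟨x, x.2, rfl⟩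
  refine trdeg_le_of_surjective (f.comp (e.symm : R.map ψ →ₐ[K] R)) ?_
  rintro ⟨_, x, hx, rfl⟩
  exact ⟨e ⟨x, hx⟩, by simp [f]; rfl⟩

end Trdeg

/-! ### Versality of faithful linear representations. -/

section Versality

variable {K : Type u} [Field K] {m : ℕ}

theorem functionFieldAction_algebraMap {G : Type w} [Group G] (ρ : G →* GL (Fin m) K) (g : G)
    (p : MvPolynomial (Fin m) K) :
    functionFieldAction ρ g (algebraMap _ (FunctionField K m) p)
      = algebraMap _ _ (polyMap (ρ g) p) := by
  exact IsFractionRing.fieldEquivOfAlgEquiv_algebraMap _ _ _ _ _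

theorem functionFieldAction_injective {G : Type w} [Group G] {ρ : G →* GL (Fin m) K}
    (hρ : Function.Injective ρ) : Function.Injective (functionFieldAction ρ) := by
  rw [injective_iff_map_eq_one]
  intro g hg
  -- The linear coefficients of `g x_i` are the entries of `ρ(g)⁻¹`, so it is `g⁻¹` that is read
  -- off.
  rw [← inv_eq_one]
  refine hρ (Units.ext (Matrix.ext fun i j => ?_))
  have h1 := functionFieldAction_algebraMap ρ g (MvPolynomial.X i)
  rw [hg, AlgEquiv.one_apply] at h1
  have h2 := congrArg (MvPolynomial.coeff (Finsupp.single j 1))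
    (IsFractionRing.injective (MvPolynomial (Fin m) K) (FunctionField K m) h1)
  simp only [polyMap, MvPolynomial.aeval_X, MvPolynomial.coeff_sum, MvPolynomial.coeff_smul,
    MvPolynomial.coeff_X, Finsupp.single_left_inj one_ne_zero, smul_eq_mul, mul_ite, mul_one,
    mul_zero, Finset.sum_ite_eq', Finset.mem_univ, if_true] at h2
  rw [map_inv, map_one, Units.val_one, Matrix.one_apply, ← h2]

variable {L : Type v} [Field L] [Algebra K L] {G : Type w} [Group G] {β : G →* (L ≃ₐ[K] L)}

/-- Dedekind independence in dual form: a functional killing all vectors `(h(c))_h` would be a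
linear relation between the automorphisms, so these vectors span `L^G` (functions on `G`), in
particular the delta function at `1`. -/
theorem exists_dual_sum [Finite G] (hβ : Function.Injective β) :
    ∃ s : L →₀ L, ∀ h, s.sum (fun c a => a * β h c) = open scoped Classical in
      if h = 1 then 1 else 0 := by
  classical
  have := Fintype.ofFinite G
  have hspan : Submodule.span L (Set.range fun (c : L) (h : G) => β h c) = ⊤ := by
    by_contra hne
    obtain ⟨f, hf0, hf⟩ := Submodule.exists_le_ker_of_lt_top _ (lt_top_iff_ne_top.mpr hne)
    have hdec : ∀ v : G → L, f v = ∑ h, v h * f (Pi.single h 1) := by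
      intro v
      conv_lhs => rw [pi_eq_sum_univ' v, map_sum]
      refine Finset.sum_congr rfl fun h _ => ?_
      rw [map_smul, smul_eq_mul]
    have hli := (linearIndependent_monoidHom L L).comp (fun h : G => ((β h : L →* L)))
      (fun g h hgh => hβ (AlgEquiv.ext fun x => DFunLike.congr_fun hgh x))
    rw [Fintype.linearIndependent_iff] at hli
    have h0 := hli (fun h => f (Pi.single h 1)) (by
      ext c
      have := hf (Submodule.subset_span ⟨c, rfl⟩)
      rw [LinearMap.mem_ker, hdec] at this
      simpa [mul_comm] using this)
    exact hf0 (LinearMap.ext fun v => by simp [hdec v, h0])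
  have hmem : (Pi.single 1 1 : G → L) ∈
      Submodule.span L (Set.range fun (c : L) (h : G) => β h c) := hspan ▸ trivial
  obtain ⟨s, hs⟩ := Finsupp.mem_span_range_iff_exists_finsupp.mp hmem
  refine ⟨s, fun h => ?_⟩
  have := congrFun hs h
  rw [Pi.single_apply] at this
  rw [← this, Finsupp.sum, Finsupp.sum, Finset.sum_apply]
  rfl

theorem infinite_fixedField [Finite G] [Infinite L] (hβ : Function.Injective β) :
    Infinite (IntermediateField.fixedField β.range) := by
  by_contra hfin
  rw [not_infinite_iff_finite] at hfin
  have : FiniteDimensional (IntermediateField.fixedField β.range) L :=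
    Module.finite_of_finrank_pos (finrank_fixedField_range hβ ▸ Nat.card_pos)
  exact not_finite_iff_infinite.mpr ‹Infinite L›
    (Module.finite_of_finite (IntermediateField.fixedField β.range))

/-- Equivariant `L`-points of a representation are Zariski dense, for a faithful `G`-field `L`. -/
theorem exists_equivariant_point [Finite G] [Infinite L] (hβ : Function.Injective β)
    (ρ : G →* GL (Fin m) K) {Q : MvPolynomial (Fin m) K} (hQ : Q ≠ 0) :
    ∃ w : Fin m → L, (∀ g p, β g (MvPolynomial.aeval w p) = MvPolynomial.aeval w (polyMap (ρ g) p))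
      ∧ MvPolynomial.aeval w Q ≠ 0 := by
  classical
  have := Fintype.ofFinite G
  obtain ⟨s, hs⟩ := exists_dual_sum hβ
  -- Column `l` of the averaged matrix `∑ ρ(h) h(c)`: an equivariant vector for every `c`.
  -- Combinations of these with coefficients in the fixed field are again equivariant.
  let a : Fin m → Fin m → L → L := fun j l c => ∑ h, algebraMap K L ((ρ h).1 j l) * β h c
  have ha : ∀ g i l c, β g (a i l c) =
      ∑ j, algebraMap K L ((ρ g⁻¹).1 i j) * a j l c := by
    intro g i l c
    simp only [a, Finset.mul_sum, map_sum]
    rw [Finset.sum_comm, ← Equiv.sum_comp (Equiv.mulLeft g⁻¹)]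
    refine Finset.sum_congr rfl fun h _ => ?_
    simp only [Equiv.coe_mulLeft, map_mul, AlgEquiv.commutes, Units.val_mul, Matrix.mul_apply,
      map_sum, Finset.sum_mul, mul_assoc]
    refine Finset.sum_congr rfl fun j _ => ?_
    rw [← AlgEquiv.mul_apply, ← map_mul, ← map_mul, mul_inv_cancel_left]
  let W : Fin m → MvPolynomial (Fin m × L) L := fun j =>
    ∑ l, ∑ c ∈ s.support, MvPolynomial.C (a j l c) * MvPolynomial.X (l, c)
  have hW : ∀ (t : Fin m × L → L) j, MvPolynomial.eval t (W j) =
      ∑ l, ∑ c ∈ s.support, a j l c * t (l, c) := by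
    intro t j
    simp [W]
  have hWQ : ∀ t : Fin m × L → L, MvPolynomial.eval t (MvPolynomial.aeval W Q) =
      MvPolynomial.aeval (fun j => MvPolynomial.eval t (W j)) Q := by
    intro t
    have h1 := MvPolynomial.comp_aeval_apply W
      ((MvPolynomial.aeval (R := L) t).restrictScalars K) Q
    simpa [MvPolynomial.aeval_eq_eval] using h1
  obtain ⟨y, hy⟩ : ∃ y : Fin m → L, MvPolynomial.aeval y Q ≠ 0 := by
    by_contra! h
    apply hQ
    apply MvPolynomial.map_injective _ (algebraMap K L).injective
    rw [map_zero]
    apply MvPolynomial.funext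
    intro x
    rw [MvPolynomial.eval_map, map_zero, ← MvPolynomial.aeval_def, h]
  have hQ' : MvPolynomial.aeval W Q ≠ 0 := by
    intro h0
    apply hy
    -- With coefficients allowed in all of `L`, the dual sum isolates the term `h = 1`, so the
    -- parametrization `W` reaches an arbitrary `y`. Hence `Q` pulled back along `W` is a nonzero
    -- polynomial.
    have h1 := hWQ (fun p => y p.1 * s p.2)
    rw [h0, map_zero] at h1
    rw [h1]
    congr 2
    ext j
    rw [hW]
    have h2 : ∀ l, ∑ c ∈ s.support, a j l c * (y l * s c) = if j = l then y l else 0 := by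
      intro l
      calc ∑ c ∈ s.support, a j l c * (y l * s c)
          = ∑ h, algebraMap K L ((ρ h).1 j l) * y l * ∑ c ∈ s.support, s c * β h c := by
            simp only [a, Finset.sum_mul, Finset.mul_sum]
            rw [Finset.sum_comm]
            refine Finset.sum_congr rfl fun h _ => Finset.sum_congr rfl fun c _ => by ring
        _ = ∑ h, algebraMap K L ((ρ h).1 j l) * y l * (if h = 1 then 1 else 0) :=
            Finset.sum_congr rfl fun h _ => by rw [← hs h]; rfl
        _ = if j = l then y l else 0 := by
            simp [Matrix.one_apply, apply_ite (algebraMap K L)]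
    simp [h2]
  -- A nonzero polynomial over `L` cannot vanish at all points with coordinates in the infinite
  -- fixed field.
  obtain ⟨t, ht, htQ⟩ : ∃ t : Fin m × L → L, (∀ i g, β g (t i) = t i) ∧
      MvPolynomial.eval t (MvPolynomial.aeval W Q) ≠ 0 := by
    by_contra! h
    apply hQ'
    have hinf := infinite_fixedField hβ
    refine MvPolynomial.funext_set
      (fun _ => (IntermediateField.fixedField β.range : Set L))
      (fun _ => Set.infinite_coe_iff.mp hinf) fun x hx => ?_
    rw [map_zero]
    exact h x fun i g => mem_fixedField_range.mp (hx i trivial) g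
  refine ⟨fun j => MvPolynomial.eval t (W j), fun g p => ?_, by rwa [← hWQ]⟩
  have h1 : (β g : L →ₐ[K] L).comp (MvPolynomial.aeval fun j => MvPolynomial.eval t (W j)) =
      (MvPolynomial.aeval fun j => MvPolynomial.eval t (W j)).comp (polyMap (ρ g)) := by
    apply MvPolynomial.algHom_ext
    intro i
    have ht' : ∀ j, β g (MvPolynomial.eval t (W j)) =
        ∑ l, ∑ c ∈ s.support, β g (a j l c) * t (l, c) := by
      intro j
      simp only [hW, map_sum, map_mul, ht]
    calc β g (MvPolynomial.aeval (fun j => MvPolynomial.eval t (W j)) (MvPolynomial.X i))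
        = ∑ l, ∑ c ∈ s.support, ∑ j, algebraMap K L ((ρ g⁻¹).1 i j) * a j l c * t (l, c) := by
          simp only [MvPolynomial.aeval_X, ht', ha, Finset.sum_mul]
      _ = ∑ j, algebraMap K L ((ρ g⁻¹).1 i j) * MvPolynomial.eval t (W j) := by
          simp only [hW, Finset.mul_sum, ← mul_assoc]
          rw [eq_comm, Finset.sum_comm (s := Finset.univ (α := Fin m))]
          exact Finset.sum_congr rfl fun l _ => Finset.sum_comm
      _ = _ := by
          simp [polyMap, Algebra.smul_def]
  exact DFunLike.congr_fun h1 p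

theorem exists_common_denominator {ι : Type*} [Finite ι] (f : ι → FunctionField K m) :
    ∃ (q : MvPolynomial (Fin m) K) (p : ι → MvPolynomial (Fin m) K), q ≠ 0 ∧
      ∀ i, f i * algebraMap _ _ q = algebraMap _ _ (p i) := by
  obtain ⟨q, hq⟩ := IsLocalization.exist_integer_multiples_of_finite
    (nonZeroDivisors (MvPolynomial (Fin m) K)) f
  choose p hp using hq
  refine ⟨q, p, nonZeroDivisors.ne_zero q.2, fun i => ?_⟩
  rw [hp, Algebra.smul_def, mul_comm]

/-- Specialization of a finite family in `K(V)` at an `L`-point `w` of `V` where the common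
denominator does not vanish. -/
theorem exists_specialization {ι : Type*} {f : ι → FunctionField K m}
    {q : MvPolynomial (Fin m) K} {p : ι → MvPolynomial (Fin m) K}
    (hq : q ≠ 0) (hp : ∀ i, f i * algebraMap _ _ q = algebraMap _ _ (p i))
    (w : Fin m → L) (hw : MvPolynomial.aeval w q ≠ 0) :
    ∃ (r : ι → Localization.Away q) (ψ : Localization.Away q →ₐ[K] FunctionField K m)
      (φ : Localization.Away q →ₐ[K] L), Function.Injective ψ ∧ f = ψ ∘ r ∧
      (fun i => MvPolynomial.aeval w (p i) / MvPolynomial.aeval w q) = φ ∘ r := by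
  have hq' : algebraMap _ (FunctionField K m) q ≠ 0 := by
    rwa [Ne, FaithfulSMul.algebraMap_eq_zero_iff]
  let ψ : Localization.Away q →ₐ[K] FunctionField K m :=
    IsLocalization.liftAlgHom (M := Submonoid.powers q)
      (f := Algebra.algHom K (MvPolynomial (Fin m) K) (FunctionField K m)) (by
        rintro ⟨_, n, rfl⟩
        rw [map_pow]
        exact (IsUnit.mk0 _ hq').pow n)
  let φ : Localization.Away q →ₐ[K] L :=
    IsLocalization.liftAlgHom (M := Submonoid.powers q) (f := MvPolynomial.aeval w) (by
        rintro ⟨_, n, rfl⟩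
        rw [map_pow]
        exact (IsUnit.mk0 _ hw).pow n)
  refine ⟨fun i => IsLocalization.mk' _ (p i) (⟨q, 1, pow_one q⟩ : Submonoid.powers q), ψ, φ,
    ?_, ?_, ?_⟩
  · refine (IsLocalization.lift_injective_iff _).mpr fun x y => ?_
    have h1 := IsLocalization.injective (Localization.Away q)
      (powers_le_nonZeroDivisors_of_noZeroDivisors hq)
    have h2 := FaithfulSMul.algebraMap_injective (MvPolynomial (Fin m) K) (FunctionField K m)
    exact ⟨fun h => congrArg _ (h1 h), fun h => congrArg _ (h2 h)⟩
  · ext i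
    refine ((IsLocalization.lift_mk'_spec _ _ _ _).mpr ?_).symm
    rw [mul_comm]
    exact (hp i).symm
  · ext i
    refine ((IsLocalization.lift_mk'_spec _ _ _ _).mpr ?_).symm
    exact (mul_div_cancel₀ _ hw).symm

/-- A faithful representation `V` is versal: a compression of `K(V)` specializes to a compression
of any faithful infinite `G`-field. -/
theorem IsCompression.specialize {L : Type u} [Field L] [Algebra K L] {β : G →* (L ≃ₐ[K] L)}
    [Finite G] [Infinite L] (hβ : Function.Injective β)
    {ρ : G →* GL (Fin m) K} {E : IntermediateField K (FunctionField K m)}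
    (hE : IsCompression (functionFieldAction ρ) E) :
    ∃ E' : IntermediateField K L, IsCompression β E' ∧ Algebra.trdeg K E' ≤ Algebra.trdeg K E := by
  classical
  have := Fintype.ofFinite G
  obtain ⟨f, hfE, hf, hf'⟩ := hE.exists_family
  obtain ⟨q, p, hq, hp⟩ := exists_common_denominator f
  have hinj := FaithfulSMul.algebraMap_injective (MvPolynomial (Fin m) K) (FunctionField K m)
  have hq' : algebraMap _ (FunctionField K m) q ≠ 0 := by
    rwa [Ne, FaithfulSMul.algebraMap_eq_zero_iff]
  have hpne : ∀ g ∈ Finset.univ.erase (1 : G), p (g, g) - p (1, g) ≠ 0 := by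
    intro g hg h0
    refine hf' g (Finset.ne_of_mem_erase hg) (mul_right_cancel₀ hq' ?_)
    rw [hp, hp, sub_eq_zero.mp h0]
  -- One polynomial controls both conditions: `q` keeps the specialization defined, and the
  -- differences of numerators keep every `g ≠ 1` acting nontrivially.
  obtain ⟨w, hw, hwQ⟩ := exists_equivariant_point hβ ρ
    (mul_ne_zero hq (Finset.prod_ne_zero_iff.mpr hpne))
  rw [map_mul, map_prod] at hwQ
  have hwq := left_ne_zero_of_mul hwQ
  have hwp := Finset.prod_ne_zero_iff.mp (right_ne_zero_of_mul hwQ)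
  obtain ⟨r, ψ, φ, hψ, hr, hr'⟩ := exists_specialization hq hp w hwq
  refine ⟨IntermediateField.adjoin K (Set.range (φ ∘ r)), isCompression_adjoin_family ?_ ?_, ?_⟩
  · rw [← hr']
    intro g h k
    have h1 := congrArg (functionFieldAction ρ g) (hp (h, k))
    rw [map_mul, hf, functionFieldAction_algebraMap, functionFieldAction_algebraMap] at h1
    -- The denominator `q` need not be invariant, so equivariance is transported in cross-multiplied
    -- form.
    have h2 : p (g * h, k) * polyMap (ρ g) q = polyMap (ρ g) (p (h, k)) * q := by
      apply hinj
      rw [map_mul, map_mul, ← h1, ← hp]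
      ring
    have h3 := congrArg (MvPolynomial.aeval w) h2
    rw [map_mul, map_mul, ← hw, ← hw] at h3
    have h4 : β g (MvPolynomial.aeval w q) ≠ 0 := (map_ne_zero _).mpr hwq
    simp only [map_div₀]
    rw [div_eq_div_iff h4 hwq, h3]
  · rw [← hr']
    intro g hg h0
    apply hwp g (Finset.mem_erase.mpr ⟨hg, Finset.mem_univ _⟩)
    rw [map_sub, sub_eq_zero]
    exact (div_left_inj' hwq).mp h0
  · refine (trdeg_adjoin_range_le r ψ hψ φ).trans ?_
    rw [← hr]
    refine trdeg_le_of_le (IntermediateField.adjoin_le_iff.mpr ?_)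
    rintro _ ⟨i, rfl⟩
    exact hfE i

end Versality

/-! ### The permutation representation of `S_n`. -/

section PermutationRepresentation

variable (K : Type u) [Field K] (n : ℕ)

/-- The permutation representation of `S_n` on `K^n`. -/
def permRep : Equiv.Perm (Fin n) →* GL (Fin n) K :=
  MonoidHom.toHomUnits
    { toFun := fun σ => (σ⁻¹).permMatrix K
      map_one' := by simp
      map_mul' := fun σ τ => by rw [mul_inv_rev, Matrix.permMatrix_mul] }

variable {n} in
theorem polyMap_permRep_X (σ : Equiv.Perm (Fin n)) (i : Fin n) :
    polyMap (permRep K n σ) (MvPolynomial.X i) = MvPolynomial.X (σ i) := by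
  have h : ∀ j, ((permRep K n σ)⁻¹).1 i j = if σ i = j then 1 else 0 := fun j => by
    rw [← map_inv]
    change (σ⁻¹⁻¹).permMatrix K i j = _
    simp [Equiv.Perm.permMatrix, PEquiv.toMatrix_apply]
  simp [polyMap, -Matrix.coe_units_inv, h]

theorem permRep_injective : Function.Injective (permRep K n) := by
  rw [injective_iff_map_eq_one]
  intro σ hσ
  ext1 i
  have := polyMap_permRep_X K σ i
  rw [hσ, polyMap_one] at this
  exact (MvPolynomial.X_injective this).symm

variable {n}

/-- The coordinate functions of `K^n`. -/
abbrev coord (i : Fin n) : FunctionField K n :=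
  algebraMap (MvPolynomial (Fin n) K) _ (MvPolynomial.X i)

theorem functionFieldAction_coord (σ : Equiv.Perm (Fin n)) (i : Fin n) :
    functionFieldAction (permRep K n) σ (coord K i) = coord K (σ i) := by
  rw [functionFieldAction_algebraMap, polyMap_permRep_X]

theorem coord_injective : Function.Injective (coord K (n := n)) :=
  (FaithfulSMul.algebraMap_injective _ _).comp MvPolynomial.X_injective

end PermutationRepresentation

/-! ### Generators for fields of ratios, difference ratios and cross-ratios. -/

section RatioFields

variable {K L : Type u} [Field K] [Field L] [Algebra K L] {k : ℕ}

theorem trdeg_adjoin_range_fin_le (c : Fin k → L) :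
    Algebra.trdeg K (IntermediateField.adjoin K (Set.range c)) ≤ k := by
  rw [trdeg_adjoin, Algebra.adjoin_range_eq_range_aeval]
  refine (trdeg_le_of_surjective _ (MvPolynomial.aeval c).rangeRestrict_surjective).trans ?_
  rw [MvPolynomial.trdeg_of_isDomain]
  simp

theorem exists_adjoin_ratio (x : Fin (k + 1) → L) (hx : ∀ i, x i ≠ 0) :
    ∃ c : Fin k → L, ∀ i j, x i / x j ∈ IntermediateField.adjoin K (Set.range c) := by
  refine ⟨fun i => x i.succ / x 0, fun i j => ?_⟩
  set A := IntermediateField.adjoin K (Set.range fun i : Fin k => x i.succ / x 0)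
  have h : ∀ i, x i / x 0 ∈ A := by
    refine Fin.cases ?_ fun i => ?_
    · rw [div_self (hx 0)]
      exact one_mem _
    · exact IntermediateField.subset_adjoin _ _ ⟨i, rfl⟩
  rw [← div_div_div_cancel_right₀ (hx 0)]
  exact div_mem (h i) (h j)

/-- Affine invariants: normalize `x 0` to `0` and `x 1` to `1`; the remaining `k` coordinates
generate. -/
theorem exists_adjoin_difference_ratio (x : Fin (k + 2) → L) (hx : Function.Injective x) :
    ∃ c : Fin k → L, ∀ i j l, (x i - x l) / (x j - x l) ∈
      IntermediateField.adjoin K (Set.range c) := by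
  have h10 : x 1 - x 0 ≠ 0 := sub_ne_zero.mpr (hx.ne (by simp))
  refine ⟨fun i => (x i.succ.succ - x 0) / (x 1 - x 0), fun i j l => ?_⟩
  set A := IntermediateField.adjoin K
    (Set.range fun i : Fin k => (x i.succ.succ - x 0) / (x 1 - x 0))
  have h : ∀ i, (x i - x 0) / (x 1 - x 0) ∈ A := by
    refine Fin.cases ?_ (Fin.cases ?_ fun i => ?_)
    · rw [sub_self, zero_div]
      exact zero_mem _
    · rw [Fin.succ_zero_eq_one, div_self h10]
      exact one_mem _
    · exact IntermediateField.subset_adjoin _ _ ⟨i, rfl⟩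
  have h' : ∀ i j, (x i - x j) / (x 1 - x 0) ∈ A := fun i j => by
    rw [← sub_sub_sub_cancel_right _ _ (x 0), sub_div]
    exact sub_mem (h i) (h j)
  rw [← div_div_div_cancel_right₀ h10]
  exact div_mem (h' i l) (h' j l)

/-- Projective invariants: normalize `x 0, x 1, x 2` to `0, 1, ∞`. A Möbius map multiplies `x i - x
j` by a factor depending on `i` times one depending on `j`, and these cancel in a cross-ratio. -/
theorem exists_adjoin_cross_ratio (x : Fin (k + 3) → L) (hx : Function.Injective x) :
    ∃ c : Fin k → L, ∀ i j l m, (x i - x l) * (x j - x m) / ((x i - x m) * (x j - x l)) ∈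
      IntermediateField.adjoin K (Set.range c) := by
  have hne : ∀ {i j}, i ≠ j → x i - x j ≠ 0 := fun h => sub_ne_zero.mpr (hx.ne h)
  have h10 : x 1 - x 0 ≠ 0 := hne (by simp)
  have h12 : x 1 - x 2 ≠ 0 := hne (by simp [Fin.ext_iff, Nat.mod_eq_of_lt (show 2 < k + 3 by omega)])
  have h02 : x 0 - x 2 ≠ 0 := hne (by simp [Fin.ext_iff, Nat.mod_eq_of_lt (show 2 < k + 3 by omega)])
  let c : Fin (k + 3) → L := fun i => (x i - x 0) * (x 1 - x 2) / ((x i - x 2) * (x 1 - x 0))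
  refine ⟨fun i => c i.succ.succ.succ, fun i j l m => ?_⟩
  set A := IntermediateField.adjoin K (Set.range fun i : Fin k => c i.succ.succ.succ)
  have hc : ∀ i, i ≠ 2 → c i ∈ A := by
    refine Fin.cases ?_ (Fin.cases ?_ (Fin.cases ?_ fun i => ?_)) <;> intro h2
    · simp only [c, sub_self, zero_mul, zero_div]
      exact zero_mem _
    · have : c 1 = 1 := by simp only [c]; rw [mul_comm, div_self (mul_ne_zero h12 h10)]
      exact this ▸ one_mem _
    · exact absurd rfl h2
    · exact IntermediateField.subset_adjoin _ _ ⟨i, rfl⟩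
  let b : L := (x 1 - x 0) / ((x 1 - x 2) * (x 0 - x 2))
  -- The index `2` sits at infinity, where `c 2` is a meaningless division by zero. The values `b⁻¹`
  -- here and `0, ±1` in `e` make the factorization `hD` hold for all indices.
  let T : Fin (k + 3) → L := fun i => if i = 2 then b⁻¹ else x i - x 2
  let e : Fin (k + 3) → Fin (k + 3) → L := fun i j =>
    if i = 2 then (if j = 2 then 0 else -1) else (if j = 2 then 1 else c i - c j)
  have hb : b ≠ 0 := div_ne_zero h10 (mul_ne_zero h12 h02)
  have hT : ∀ i, T i ≠ 0 := fun i => by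
    simp only [T]
    split_ifs with h
    · exact inv_ne_zero hb
    · exact hne h
  have he : ∀ i j, e i j ∈ A := fun i j => by
    simp only [e]
    split_ifs with h h'
    exacts [zero_mem _, neg_mem (one_mem _), one_mem _, sub_mem (hc _ h) (hc _ ‹_›)]
  have hD : ∀ i j, x i - x j = b * T i * T j * e i j := fun i j => by
    simp only [e, T]
    split_ifs with hi hj hj
    · rw [hi, hj]; simp
    · rw [hi]; field_simp; ring
    · rw [hj]; field_simp
    · have := hne hi
      have := hne hj
      simp only [c, b]
      field_simp
      ring
  have : (x i - x l) * (x j - x m) / ((x i - x m) * (x j - x l)) =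
      e i l * e j m / (e i m * e j l) := by
    have h1 : b * b * T i * T j * T l * T m ≠ 0 := by simp [hb, hT]
    rw [hD i l, hD j m, hD i m, hD j l, ← mul_div_mul_left (e i l * e j m) _ h1]
    congr 1 <;> ring
  rw [this]
  exact div_mem (mul_mem (he _ _) (he _ _)) (mul_mem (he _ _) (he _ _))

end RatioFields

/-! ### Faithful compressions of the permutation representation. -/

section UpperBounds

variable (K : Type u) [Field K]

open MvPolynomial in
theorem coord_ne_zero {n : ℕ} (i : Fin n) : coord K i ≠ 0 := by
  rw [Ne, FaithfulSMul.algebraMap_eq_zero_iff]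
  exact X_ne_zero i

theorem coord_sub_ne_zero {n : ℕ} {i j : Fin n} (h : i ≠ j) : coord K i - coord K j ≠ 0 :=
  sub_ne_zero.mpr ((coord_injective K).ne h)

theorem exists_apply_ne {n : ℕ} {σ : Equiv.Perm (Fin n)} (hσ : σ ≠ 1) : ∃ i, σ i ≠ i := by
  by_contra! h
  exact hσ (Equiv.ext h)

open MvPolynomial in
theorem X_sub_X_ne_zero {n : ℕ} {i j : Fin n} (h : i ≠ j) :
    (X i - X j : MvPolynomial (Fin n) K) ≠ 0 :=
  sub_ne_zero.mpr (X_injective.ne h)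

theorem adjoin_range_trdeg_le {k n : ℕ} {ι : Type*} {f : ι → FunctionField K n}
    {c : Fin k → FunctionField K n}
    (h : ∀ i, f i ∈ IntermediateField.adjoin K (Set.range c)) :
    Algebra.trdeg K (IntermediateField.adjoin K (Set.range f)) ≤ k := by
  refine (trdeg_le_of_le ?_).trans (trdeg_adjoin_range_fin_le c)
  rw [IntermediateField.adjoin_le_iff]
  rintro _ ⟨i, rfl⟩
  exact h i

open MvPolynomial in
theorem exists_compression_ratio (k : ℕ) : ∃ E,
    IsCompression (functionFieldAction (permRep K (k + 1))) E ∧ Algebra.trdeg K E ≤ k := by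
  obtain ⟨c, hc⟩ := exists_adjoin_ratio (K := K) (coord K (n := k + 1)) (coord_ne_zero K)
  let f : Fin (k + 1) × Fin (k + 1) → FunctionField K (k + 1) := fun p => coord K p.1 / coord K p.2
  refine ⟨IntermediateField.adjoin K (Set.range f), isCompression_adjoin_range ?_ ?_,
    adjoin_range_trdeg_le K fun i => hc _ _⟩
  · rintro σ ⟨i, j⟩
    exact ⟨(σ i, σ j), by simp only [f, map_div₀, functionFieldAction_coord]⟩
  · intro σ hσ
    by_contra! h
    obtain ⟨i, hi⟩ := exists_apply_ne hσ
    have h1 := h (i, σ i)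
    simp only [f, map_div₀, functionFieldAction_coord] at h1
    rw [div_eq_div_iff (coord_ne_zero K _) (coord_ne_zero K _), ← map_mul, ← map_mul] at h1
    have h2 := FaithfulSMul.algebraMap_injective _ _ h1
    -- Invariance of `x_i / x_{σ i}` reads `x_{σ i}² = x_i x_{σ² i}`; setting `x_{σ i} = 0` kills
    -- only the left side.
    have h3 := congrArg (aeval (R := K)
      (Function.update (X : Fin (k + 1) → MvPolynomial (Fin (k + 1)) K) (σ i) 0)) h2
    have hi' : σ (σ i) ≠ σ i := σ.injective.ne hi
    simp [Function.update_of_ne hi.symm, Function.update_of_ne hi'] at h3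

open MvPolynomial in
theorem exists_compression_difference_ratio {k : ℕ} (hk : 1 ≤ k) : ∃ E,
    IsCompression (functionFieldAction (permRep K (k + 2))) E ∧ Algebra.trdeg K E ≤ k := by
  obtain ⟨c, hc⟩ := exists_adjoin_difference_ratio (K := K) (coord K (n := k + 2))
    (coord_injective K)
  let f : {p : Fin (k + 2) × Fin (k + 2) × Fin (k + 2) // p.2.1 ≠ p.2.2} →
    FunctionField K (k + 2) := fun p =>
      (coord K p.1.1 - coord K p.1.2.2) / (coord K p.1.2.1 - coord K p.1.2.2)
  refine ⟨IntermediateField.adjoin K (Set.range f), isCompression_adjoin_range ?_ ?_,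
    adjoin_range_trdeg_le K fun i => hc _ _ _⟩
  · rintro σ ⟨⟨i, j, l⟩, hjl⟩
    exact ⟨⟨(σ i, σ j, σ l), σ.injective.ne hjl⟩, by
      simp only [f, map_div₀, map_sub, functionFieldAction_coord]⟩
  · intro σ hσ
    by_contra! h
    obtain ⟨i, hi⟩ := exists_apply_ne hσ
    obtain ⟨l, hl⟩ : ∃ l, l ∉ ({i, σ i} : Finset (Fin (k + 2))) := by
      by_contra! h'
      have := Finset.card_le_card (fun l _ => h' l : Finset.univ ⊆ _)
      have := Finset.card_le_two (a := i) (b := σ i)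
      simp at *
      omega
    simp only [Finset.mem_insert, Finset.mem_singleton, not_or] at hl
    have h1 := h ⟨(i, σ i, l), fun h => hl.2 h.symm⟩
    simp only [f, map_div₀, map_sub, functionFieldAction_coord] at h1
    have hl' : σ (σ i) ≠ σ l := σ.injective.ne fun h => hl.2 h.symm
    rw [div_eq_div_iff (coord_sub_ne_zero K hl') (coord_sub_ne_zero K (Ne.symm hl.2))] at h1
    simp only [← map_mul, ← map_sub] at h1
    have h2 := FaithfulSMul.algebraMap_injective _ _ h1
    -- Substituting `x_{σ l}` for `x_{σ i}` kills the left side, whereas no factor on the right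
    -- vanishes.
    have h3 := congrArg (rename (R := K) (Function.update id (σ i) (σ l))) h2
    have hi' : σ (σ i) ≠ σ i := σ.injective.ne hi
    have hli : σ l ≠ σ i := σ.injective.ne hl.1
    simp [Function.update_of_ne hi.symm, Function.update_of_ne hi', Function.update_of_ne hli,
      Function.update_of_ne hl.2, X_sub_X_ne_zero K (Ne.symm hl.1), X_sub_X_ne_zero K hl'] at h3

open MvPolynomial in
theorem exists_compression_cross_ratio {k : ℕ} (hk : 2 ≤ k) : ∃ E,
    IsCompression (functionFieldAction (permRep K (k + 3))) E ∧ Algebra.trdeg K E ≤ k := by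
  obtain ⟨c, hc⟩ := exists_adjoin_cross_ratio (K := K) (coord K (n := k + 3)) (coord_injective K)
  let f : {p : Fin (k + 3) × Fin (k + 3) × Fin (k + 3) × Fin (k + 3) //
      p.1 ≠ p.2.2.2 ∧ p.2.1 ≠ p.2.2.1} → FunctionField K (k + 3) := fun p =>
    (coord K p.1.1 - coord K p.1.2.2.1) * (coord K p.1.2.1 - coord K p.1.2.2.2) /
      ((coord K p.1.1 - coord K p.1.2.2.2) * (coord K p.1.2.1 - coord K p.1.2.2.1))
  refine ⟨IntermediateField.adjoin K (Set.range f), isCompression_adjoin_range ?_ ?_,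
    adjoin_range_trdeg_le K fun i => hc _ _ _ _⟩
  · rintro σ ⟨⟨i, j, l, m⟩, him, hjl⟩
    exact ⟨⟨(σ i, σ j, σ l, σ m), σ.injective.ne him, σ.injective.ne hjl⟩, by
      simp only [f, map_div₀, map_mul, map_sub, functionFieldAction_coord]⟩
  · intro σ hσ
    by_contra! h
    obtain ⟨i, hi⟩ := exists_apply_ne hσ
    -- Three points besides `i` and `σ i`: this is where `n ≥ 5` enters. On four letters the Klein
    -- group fixes all cross-ratios.
    obtain ⟨j, hj, l, hl, m, hm, hjl, hjm, hlm⟩ :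
        ∃ a ∈ ({i, σ i}ᶜ : Finset (Fin (k + 3))), ∃ b ∈ ({i, σ i}ᶜ : Finset (Fin (k + 3))),
          ∃ c ∈ ({i, σ i}ᶜ : Finset (Fin (k + 3))), a ≠ b ∧ a ≠ c ∧ b ≠ c := by
      rw [← Finset.two_lt_card, Finset.card_compl, Fintype.card_fin]
      have := Finset.card_le_two (a := i) (b := σ i)
      omega
    simp only [Finset.mem_compl, Finset.mem_insert, Finset.mem_singleton, not_or] at hj hl hm
    have h1 := h ⟨(i, j, l, m), Ne.symm hm.1, hjl⟩
    have him' : σ i ≠ σ m := σ.injective.ne (Ne.symm hm.1)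
    have hjl' : σ j ≠ σ l := σ.injective.ne hjl
    have hlm' : σ l ≠ σ m := σ.injective.ne hlm
    have hji' : σ j ≠ σ i := σ.injective.ne hj.1
    have hli' : σ l ≠ σ i := σ.injective.ne hl.1
    simp only [f, map_div₀, map_mul, map_sub, functionFieldAction_coord] at h1
    rw [div_eq_div_iff (mul_ne_zero (coord_sub_ne_zero K him') (coord_sub_ne_zero K hjl'))
      (mul_ne_zero (coord_sub_ne_zero K (Ne.symm hm.1)) (coord_sub_ne_zero K hjl))] at h1
    simp only [← map_mul, ← map_sub] at h1
    have h2 := FaithfulSMul.algebraMap_injective _ _ h1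
    have h3 := congrArg (rename (R := K) (Function.update id (σ i) (σ l))) h2
    simp [Function.update_of_ne hi.symm, Function.update_of_ne hji', Function.update_of_ne hli',
      Function.update_of_ne him'.symm, Function.update_of_ne hj.2, Function.update_of_ne hl.2,
      Function.update_of_ne hm.2, X_sub_X_ne_zero K (Ne.symm hl.1), X_sub_X_ne_zero K hjm,
      X_sub_X_ne_zero K hlm', X_sub_X_ne_zero K hjl'] at h3

end UpperBounds

/-! ### Characters of the value group acting on Hahn series. -/

section Twist

variable {K : Type u} [Field K] {Γ : Type v} [AddCommGroup Γ] [LinearOrder Γ] [IsOrderedAddMonoid Γ]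

omit [LinearOrder Γ] [IsOrderedAddMonoid Γ] in
theorem character_ne_zero (χ : Multiplicative Γ →* K) (γ : Γ) : χ (Multiplicative.ofAdd γ) ≠ 0 :=
  ((Group.isUnit (Multiplicative.ofAdd γ)).map χ).ne_zero

/-- Multiplication of the coefficient at `γ` by `χ γ`, for a character `χ` of `Γ`. -/
def twistFun (χ : Multiplicative Γ →* K) (x : HahnSeries Γ K) : HahnSeries Γ K where
  coeff γ := χ (Multiplicative.ofAdd γ) * x.coeff γ
  isPWO_support' := x.isPWO_support.mono fun _ h => right_ne_zero_of_mul h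

omit [IsOrderedAddMonoid Γ] in
theorem support_twistFun (χ : Multiplicative Γ →* K) (x : HahnSeries Γ K) :
    (twistFun χ x).support = x.support := by
  ext γ
  simp [twistFun, character_ne_zero]

/-- The automorphism of the field of Hahn series given by a character of the value group. -/
def twist (χ : Multiplicative Γ →* K) : HahnSeries Γ K →ₐ[K] HahnSeries Γ K where
  toFun := twistFun χ
  map_one' := by
    ext γ
    by_cases h : γ = 0 <;> simp [twistFun, HahnSeries.coeff_one, h]
  map_zero' := by ext; simp [twistFun]
  map_add' x y := by ext; simp [twistFun, mul_add]
  map_mul' x y := by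
    ext γ
    change _ * (x * y).coeff γ = _
    rw [HahnSeries.coeff_mul, HahnSeries.coeff_mul, Finset.mul_sum]
    refine Finset.sum_congr ?_ ?_
    · ext p
      simp [support_twistFun]
    · intro p hp
      have h : p.1 + p.2 = γ := (Finset.mem_antidiagonal.mp hp).2.2
      simp only [twistFun, ← h, ofAdd_add, map_mul]
      ring
  commutes' c := by
    ext γ
    by_cases h : γ = 0 <;> simp [twistFun, HahnSeries.algebraMap_apply, h]

theorem coeff_twist (χ : Multiplicative Γ →* K) (x : HahnSeries Γ K) (γ : Γ) :
    (twist χ x).coeff γ = χ (Multiplicative.ofAdd γ) * x.coeff γ := rfl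

/-- The twisting action of the character group. -/
def twistAction : (Multiplicative Γ →* Kˣ) →* (HahnSeries Γ K ≃ₐ[K] HahnSeries Γ K) :=
  (AlgEquiv.algHomUnitsEquiv K (HahnSeries Γ K)).toMonoidHom.comp <| MonoidHom.toHomUnits
    { toFun := fun χ => twist ((Units.coeHom K).comp χ)
      map_one' := by ext; simp [coeff_twist]
      map_mul' := fun χ χ' => by ext; simp [coeff_twist, mul_assoc] }

end Twist

/-! ### Sign actions of `(ℤ/2)^r` and independence of orders modulo two. -/

section SignAction

variable (K : Type u) [Field K] (r : ℕ)

/-- The character of order two of the additive group of `ZMod 2`. -/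
def signChar : Multiplicative (ZMod 2) →* Kˣ where
  toFun a := if a.toAdd = 0 then 1 else -1
  map_one' := by simp
  map_mul' a b := by
    have h : ∀ c : ZMod 2, c = 0 ∨ c = 1 := by decide
    have h2 : (1 + 1 : ZMod 2) = 0 := by decide
    rw [toAdd_mul]
    rcases h a.toAdd with ha | ha <;> rcases h b.toAdd with hb | hb <;> simp [ha, hb, h2]

variable {K} in
theorem signChar_eq_one (hK : ringChar K ≠ 2) {a : ZMod 2} :
    signChar K (Multiplicative.ofAdd a) = 1 ↔ a = 0 := by
  have h1 : (-1 : Kˣ) ≠ 1 := fun h => Ring.neg_one_ne_one_of_char_ne_two hK (Units.ext_iff.mp h)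
  by_cases h : a = 0 <;> simp [signChar, h, h1]

/-- The value group `ℤ^r` with the lexicographic order. -/
abbrev LexInt : Type := Lex (Fin r → ℤ)

variable {r}

/-- Reduction modulo two. -/
def lexMod : LexInt r →+ (Fin r → ZMod 2) :=
  (Int.castAddHom (ZMod 2)).compLeft (Fin r)

theorem lexMod_apply (γ : LexInt r) (i : Fin r) : lexMod γ i = ((γ i : ℤ) : ZMod 2) := rfl

variable (r)

/-- The pairing of `(ℤ/2)^r` with `ℤ^r` with values in `±1`. -/
def signPairing : Multiplicative (Fin r → ZMod 2) →* (Multiplicative (LexInt r) →* Kˣ) where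
  toFun h := (signChar K).comp (AddMonoidHom.toMultiplicative
    ((dotProductBilin (ZMod 2) (ZMod 2) h.toAdd).toAddMonoidHom.comp lexMod))
  map_one' := by
    ext γ
    simp [toAdd_one]
  map_mul' h h' := by
    refine MonoidHom.ext fun γ => ?_
    change signChar K (Multiplicative.ofAdd ((h.toAdd + h'.toAdd) ⬝ᵥ lexMod γ.toAdd)) = _
    rw [add_dotProduct, ofAdd_add, map_mul]
    rfl

/-- The action of `(ℤ/2)^r` by signs on the field of iterated Laurent series in `r` variables. -/
def signAction : Multiplicative (Fin r → ZMod 2) →*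
    (HahnSeries (LexInt r) K ≃ₐ[K] HahnSeries (LexInt r) K) :=
  twistAction.comp (signPairing K r)

variable {K r}

theorem coeff_signAction (h : Fin r → ZMod 2) (x : HahnSeries (LexInt r) K) (γ : LexInt r) :
    (signAction K r (Multiplicative.ofAdd h) x).coeff γ =
      signChar K (Multiplicative.ofAdd (h ⬝ᵥ lexMod γ)) * x.coeff γ := rfl

theorem signAction_injective (hK : ringChar K ≠ 2) : Function.Injective (signAction K r) := by
  rw [injective_iff_map_eq_one]
  intro h hh
  induction h using Multiplicative.rec with | ofAdd h => ?_
  rw [ofAdd_eq_one]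
  ext i
  let γ : LexInt r := toLex (Pi.single i 1)
  have h1 := coeff_signAction h (HahnSeries.single γ (1 : K)) γ
  rw [hh, AlgEquiv.one_apply, HahnSeries.coeff_single_same, mul_one, eq_comm, Units.val_eq_one,
    signChar_eq_one hK] at h1
  have h2 : lexMod γ = Pi.single i 1 := by
    ext j
    rw [lexMod_apply]
    by_cases hj : j = i
    · subst hj; simp [γ]
    · simp [γ, hj]
  simpa [h2] using h1

theorem signAction_signAction (h : Multiplicative (Fin r → ZMod 2)) (x : HahnSeries (LexInt r) K) :
    signAction K r h (signAction K r h x) = x := by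
  have : h * h = 1 := by
    induction h using Multiplicative.rec with | ofAdd h => ?_
    rw [← ofAdd_add, ofAdd_eq_one]
    ext i
    exact CharTwo.add_self_eq_zero _
  rw [← AlgEquiv.mul_apply, ← map_mul, this, map_one, AlgEquiv.one_apply]

/-- Elements of a compression of the sign action have arbitrary orders modulo two. -/
theorem IsCompression.exists_lexMod_order_eq (hK : ringChar K ≠ 2)
    {E : IntermediateField K (HahnSeries (LexInt r) K)} (hE : IsCompression (signAction K r) E)
    (s : Fin r → ZMod 2) : ∃ y ∈ E, y ≠ 0 ∧ lexMod y.order = s := by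
  -- The attained orders modulo two form a subspace. If it is proper, some `h ≠ 0` is orthogonal to
  -- it, and then `h` fixes every leading coefficient in `E`. But `z = h x - x` satisfies `h z =
  -- -z`, which is absurd as `-1 ≠ 1`.
  let S : AddSubgroup (Fin r → ZMod 2) :=
    { carrier := {s | ∃ y ∈ E, y ≠ 0 ∧ lexMod y.order = s}
      zero_mem' := ⟨1, one_mem _, one_ne_zero, by rw [HahnSeries.order_one, map_zero]⟩
      add_mem' := by
        rintro _ _ ⟨y, hy, hy0, rfl⟩ ⟨z, hz, hz0, rfl⟩
        exact ⟨y * z, mul_mem hy hz, mul_ne_zero hy0 hz0, by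
          rw [HahnSeries.order_mul hy0 hz0, map_add]⟩
      neg_mem' := by
        rintro _ ⟨y, hy, hy0, rfl⟩
        refine ⟨y, hy, hy0, ?_⟩
        ext i
        exact (CharTwo.neg_eq _).symm }
  by_contra hs
  have hlt : AddSubgroup.toZModSubmodule 2 S < ⊤ := lt_top_iff_ne_top.mpr fun h => by
    have : s ∈ AddSubgroup.toZModSubmodule 2 S := h ▸ trivial
    exact hs this
  obtain ⟨f, hf0, hf⟩ := Submodule.exists_le_ker_of_lt_top _ hlt
  obtain ⟨h, rfl⟩ := (dotProductEquiv (ZMod 2) (Fin r)).surjective f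
  have hh : ∀ y ∈ E, y ≠ 0 → h ⬝ᵥ lexMod y.order = 0 := fun y hy hy0 => hf ⟨y, hy, hy0, rfl⟩
  obtain ⟨x, hx, hx'⟩ := hE.faithful (Multiplicative.ofAdd h) fun h1 => hf0 (by
    rw [ofAdd_eq_one] at h1
    rw [h1, map_zero])
  set z := signAction K r (Multiplicative.ofAdd h) x - x with hz
  have hz0 : z ≠ 0 := sub_ne_zero.mpr hx'
  have hzE : z ∈ E := sub_mem (hE.map_mem _ _ hx) hx
  have h1 : signAction K r (Multiplicative.ofAdd h) z = -z := by
    rw [hz, map_sub, signAction_signAction, neg_sub]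
  have h2 := coeff_signAction h z z.order
  rw [h1, hh z hzE hz0, ofAdd_zero, map_one, Units.val_one, one_mul, HahnSeries.coeff_neg] at h2
  have h3 : z.coeff z.order ≠ 0 := fun h => hz0 (HahnSeries.coeff_order_eq_zero.mp h)
  exact Ring.neg_one_ne_one_of_char_ne_two hK
    (mul_right_cancel₀ h3 (by rw [neg_one_mul, one_mul, h2]))

/-- The integer matrix with rows `v i` is the identity modulo two, so its determinant is odd, hence
nonzero. -/
theorem injective_sum_smul_of_lexMod {v : Fin r → LexInt r}
    (hv : ∀ i, lexMod (v i) = Pi.single i 1) :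
    Function.Injective fun a : Fin r →₀ ℕ => ∑ i, a i • v i := by
  intro a b hab
  let M : Matrix (Fin r) (Fin r) ℤ := fun i => ofLex (v i)
  have hM : M.det ≠ 0 := by
    intro h0
    have h1 : M.map (Int.castRingHom (ZMod 2)) = 1 := by
      ext i j
      have := congrFun (hv i) j
      rw [lexMod_apply] at this
      rw [Matrix.map_apply, Matrix.one_eq_pi_single, ← this]
      rfl
    have h2 := RingHom.map_det (Int.castRingHom (ZMod 2)) M
    rw [h0, map_zero, RingHom.mapMatrix_apply, h1, Matrix.det_one] at h2
    exact zero_ne_one h2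
  have h3 : (fun i => (a i : ℤ) - b i) = 0 := by
    refine Matrix.eq_zero_of_vecMul_eq_zero hM ?_
    ext j
    let π : LexInt r →+ ℤ := Pi.evalAddMonoidHom (fun _ : Fin r => ℤ) j
    have h4 := congrArg π hab
    simp only [map_sum, nsmul_eq_mul] at h4
    simp only [Matrix.vecMul, dotProduct, sub_mul, Finset.sum_sub_distrib, Pi.zero_apply,
      sub_eq_zero]
    exact h4
  ext i
  have := congrFun h3 i
  simp only [Pi.zero_apply] at this
  omega

theorem order_prod_pow {Γ : Type*} [AddCommGroup Γ] [LinearOrder Γ] [IsOrderedAddMonoid Γ]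
    {ι : Type*} {x : ι → HahnSeries Γ K} (hx : ∀ i, x i ≠ 0) (b : ι → ℕ) (s : Finset ι) :
    (∏ i ∈ s, x i ^ b i).order = ∑ i ∈ s, b i • (x i).order := by
  classical
  induction s using Finset.induction_on with
  | empty => simp
  | insert i s hi ih =>
    rw [Finset.prod_insert hi, Finset.sum_insert hi, HahnSeries.order_mul (pow_ne_zero _ (hx i))
      (Finset.prod_ne_zero_iff.mpr fun i _ => pow_ne_zero _ (hx i)), ih, HahnSeries.order_pow]

/-- Distinct monomials have distinct orders, so the term of least order in a polynomial relation
cannot cancel. -/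
theorem algebraicIndependent_of_injective_order {Γ : Type*} [AddCommGroup Γ] [LinearOrder Γ]
    [IsOrderedAddMonoid Γ] {ι : Type*} [Fintype ι] {x : ι → HahnSeries Γ K} (hx : ∀ i, x i ≠ 0)
    (hinj : Function.Injective fun a : ι →₀ ℕ => ∑ i, a i • (x i).order) :
    AlgebraicIndependent K x := by
  rw [algebraicIndependent_iff]
  intro p hp
  by_contra hp0
  obtain ⟨a, ha, hmin⟩ := p.support.exists_min_image (fun a : ι →₀ ℕ => ∑ i, a i • (x i).order)
    (MvPolynomial.support_nonempty.mpr hp0)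
  have hmon : ∀ b : ι →₀ ℕ, ∏ i, x i ^ b i ≠ 0 := fun b =>
    Finset.prod_ne_zero_iff.mpr fun i _ => pow_ne_zero _ (hx i)
  have hord : ∀ b : ι →₀ ℕ, (∏ i, x i ^ b i).order = ∑ i, b i • (x i).order :=
    fun b => order_prod_pow hx b _
  have h1 := congrArg (fun y => HahnSeries.coeff y (∑ i, a i • (x i).order)) hp
  simp only [MvPolynomial.aeval_def, MvPolynomial.eval₂_eq', HahnSeries.coeff_sum] at h1
  rw [Finset.sum_eq_single_of_mem a ha] at h1
  · rw [← Algebra.smul_def, HahnSeries.coeff_smul, ← hord, smul_eq_mul, HahnSeries.coeff_zero,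
      mul_eq_zero, HahnSeries.coeff_order_eq_zero] at h1
    exact h1.elim (MvPolynomial.mem_support_iff.mp ha) (hmon a)
  · intro b hb hba
    rw [← Algebra.smul_def, HahnSeries.coeff_smul, HahnSeries.coeff_eq_zero_of_lt_order, smul_zero]
    rw [hord]
    exact lt_of_le_of_ne (hmin b hb) (hinj.ne hba.symm)

theorem IsCompression.le_trdeg_of_signAction (hK : ringChar K ≠ 2)
    {E : IntermediateField K (HahnSeries (LexInt r) K)} (hE : IsCompression (signAction K r) E) :
    (r : Cardinal) ≤ Algebra.trdeg K E := by
  choose y hyE hy0 hy using fun i : Fin r => hE.exists_lexMod_order_eq hK (Pi.single i 1)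
  have h := algebraicIndependent_of_injective_order hy0 (injective_sum_smul_of_lexMod hy)
  have h' : AlgebraicIndependent K fun i => (⟨y i, hyE i⟩ : E) :=
    AlgebraicIndependent.of_comp E.val h
  simpa using h'.lift_cardinalMk_le_trdeg

theorem infinite_hahnSeries_lexInt (hr : r ≠ 0) : Infinite (HahnSeries (LexInt r) K) := by
  have : NeZero r := ⟨hr⟩
  have : Infinite (LexInt r) := inferInstanceAs (Infinite (Fin r → ℤ))
  refine Infinite.of_injective (fun γ : LexInt r => HahnSeries.single γ (1 : K)) fun γ δ h => ?_
  have := congrArg HahnSeries.order h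
  simpa [HahnSeries.order_single] using this

end SignAction

/-! ### Restriction to elementary abelian 2-subgroups. -/

section Restriction

theorem IsCompression.comp {K : Type u} {L : Type v} [Field K] [Field L] [Algebra K L]
    {G H : Type*} [Group G] [Group H] {α : G →* (L ≃ₐ[K] L)} {E : IntermediateField K L}
    (hE : IsCompression α E) {ι : H →* G} (hι : Function.Injective ι) :
    IsCompression (α.comp ι) E :=
  ⟨fun h => hE.map_mem (ι h), fun h hh => hE.faithful (ι h) fun h1 => hh (hι (by rw [h1, map_one]))⟩

/-- The action of `(ℤ/2)^r` on `r` copies of `ℤ/2`. -/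
def translationPerm (r : ℕ) :
    Multiplicative (Fin r → ZMod 2) →* Equiv.Perm (Fin r × ZMod 2) where
  toFun h := Equiv.prodShear (Equiv.refl _) fun i => Equiv.addLeft (h.toAdd i)
  map_one' := by ext p <;> simp
  map_mul' h h' := by ext p <;> simp

theorem translationPerm_injective (r : ℕ) : Function.Injective (translationPerm r) := by
  rw [injective_iff_map_eq_one]
  intro h hh
  have h1 : h.toAdd = 0 := by
    ext i
    have := congrArg Prod.snd (DFunLike.congr_fun hh (i, (0 : ZMod 2)))
    simpa [translationPerm] using this
  exact h1

theorem exists_injective_monoidHom_perm {r n : ℕ} (h : 2 * r ≤ n) :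
    ∃ ι : Multiplicative (Fin r → ZMod 2) →* Equiv.Perm (Fin n), Function.Injective ι := by
  obtain ⟨e⟩ := Function.Embedding.nonempty_of_card_le (α := Fin r × ZMod 2) (β := Fin n)
    (by simpa [mul_comm] using h)
  exact ⟨(Equiv.Perm.viaEmbeddingHom e).comp (translationPerm r),
    (Equiv.Perm.viaEmbeddingHom_injective e).comp (translationPerm_injective r)⟩

/-- An elementary abelian `2`-subgroup of rank `r` of `S_n` forces `ed_K(S_n) ≥ r`, away from
characteristic two. -/
theorem IsCompression.le_trdeg_of_two_mul_le {K : Type u} [Field K] (hK : ringChar K ≠ 2)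
    {m r n : ℕ} (hrn : 2 * r ≤ n) {ρ : Equiv.Perm (Fin n) →* GL (Fin m) K}
    {E : IntermediateField K (FunctionField K m)}
    (hE : IsCompression (functionFieldAction ρ) E) : (r : Cardinal) ≤ Algebra.trdeg K E := by
  -- For `r = 0` the Hahn series field is just a copy of `K`, possibly finite, so versality is
  -- unavailable; the bound is trivial.
  rcases eq_or_ne r 0 with rfl | hr
  · simp
  obtain ⟨ι, hι⟩ := exists_injective_monoidHom_perm hrn
  have := infinite_hahnSeries_lexInt (K := K) hr
  have hE' : IsCompression (functionFieldAction (ρ.comp ι)) E := hE.comp hι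
  obtain ⟨E', h1, h2⟩ := hE'.specialize (signAction_injective (r := r) hK)
  exact (h1.le_trdeg_of_signAction hK).trans h2

end Restriction

/-! ### Embedding subfields of transcendence degree at most one in `K(X)`. -/

section CurveSpecialization

variable {K : Type u} [Field K]

/-- A nonzero element of the kernel is algebraic over `K[t]`, so it divides a nonzero element of
`K[t]`, which would also be killed. -/
theorem injective_of_isTranscendenceBasis {R F : Type*} [CommRing R] [IsDomain R] [Algebra K R]
    [Field F] [Algebra K F] (φ : R →ₐ[K] F) {t : Set R}
    (ht : IsTranscendenceBasis K ((↑) : t → R))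
    (hφ : AlgebraicIndependent K (fun x : t => φ x)) : Function.Injective φ := by
  rw [injective_iff_map_eq_zero]
  intro h hh
  by_contra hne
  have halg := ht.isAlgebraic.isAlgebraic h
  obtain ⟨a, ha0, b, hb⟩ := halg.exists_nonzero_dvd (mem_nonZeroDivisors_of_ne_zero hne)
  have h1 : φ a = 0 := by
    have := congrArg φ hb
    rwa [map_mul, hh, zero_mul] at this
  obtain ⟨a, ha⟩ := a
  rw [Subtype.range_coe, ← Subtype.range_coe (s := t), Algebra.adjoin_range_eq_range_aeval] at ha
  obtain ⟨P, rfl⟩ := ha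
  have h2 : MvPolynomial.aeval (fun x : t => φ x) P = 0 := by
    rw [← h1]
    exact (MvPolynomial.comp_aeval_apply _ φ P).symm
  have h3 := hφ.eq_zero_of_aeval_eq_zero P h2
  exact ha0 (Subtype.ext (by simp [h3]))

theorem injective_of_trdeg_le_one {R : Type v} {F : Type*} [CommRing R] [IsDomain R] [Algebra K R]
    [Field F] [Algebra K F] (htr : Algebra.trdeg K R ≤ 1) (φ : R →ₐ[K] F) {ι : Type*} {r : ι → R}
    (hr : Algebra.adjoin K (Set.range r) = ⊤)
    (hφ : ∀ i, Transcendental K (r i) → Transcendental K (φ (r i))) : Function.Injective φ := by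
  have : FaithfulSMul K R :=
    (faithfulSMul_iff_algebraMap_injective _ _).mpr (algebraMap K R).injective
  have : Algebra.IsAlgebraic (Algebra.adjoin K (Set.range r)) R := by
    refine ⟨fun x => ?_⟩
    exact isAlgebraic_algebraMap (⟨x, hr ▸ trivial⟩ : Algebra.adjoin K (Set.range r))
  obtain ⟨t, hts, ht⟩ := exists_isTranscendenceBasis_subset (R := K) (Set.range r)
  have hsub : Subsingleton t := by
    rw [← Cardinal.le_one_iff_subsingleton, ht.cardinalMk_eq_trdeg]
    exact htr
  refine injective_of_isTranscendenceBasis φ ht ?_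
  rcases isEmpty_or_nonempty t with hempty | ⟨⟨x, hx⟩⟩
  · exact (algebraicIndependent_empty_type_iff).mpr (algebraMap K F).injective
  · rw [algebraicIndependent_singleton_iff ⟨x, hx⟩]
    have h1 := (algebraicIndependent_singleton_iff ⟨x, hx⟩).mp ht.1
    obtain ⟨i, rfl⟩ := hts hx
    exact hφ i h1

/-- A weight separating a finite set of exponents. -/
theorem exists_injOn_weight {m : ℕ} (T : Finset (Fin m →₀ ℕ)) :
    ∃ a : Fin m → ℕ, Set.InjOn (fun e : Fin m →₀ ℕ => ∑ i, a i * e i) T := by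
  classical
  -- A suitable weight is a point with natural coordinates off the hyperplanes orthogonal to the
  -- differences of exponents.
  let P : MvPolynomial (Fin m) ℤ := ∏ p ∈ T.offDiag,
    ∑ i, MvPolynomial.C ((p.1 i : ℤ) - p.2 i) * MvPolynomial.X i
  have hP : P ≠ 0 := by
    refine Finset.prod_ne_zero_iff.mpr fun p hp h0 => ?_
    refine (Finset.mem_offDiag.mp hp).2.2 (Finsupp.ext fun i => ?_)
    have h1 := congrArg (MvPolynomial.coeff (Finsupp.single i 1)) h0
    simp only [MvPolynomial.coeff_sum, MvPolynomial.coeff_C_mul, MvPolynomial.coeff_X,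
      Finsupp.single_left_inj one_ne_zero, mul_ite, mul_one, mul_zero, Finset.sum_ite_eq',
      Finset.mem_univ, if_true, MvPolynomial.coeff_zero] at h1
    omega
  obtain ⟨a, ha⟩ : ∃ a : Fin m → ℕ, MvPolynomial.eval (fun i => (a i : ℤ)) P ≠ 0 := by
    by_contra! h
    refine hP (MvPolynomial.funext_set (fun _ => Set.range ((↑) : ℕ → ℤ))
      (fun _ => Set.infinite_range_of_injective Nat.cast_injective) fun x hx => ?_)
    choose a ha using fun i => hx i trivial
    rw [map_zero, ← h a]
    congr 2
    exact (funext ha).symm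
  refine ⟨a, fun e he f hf hef => ?_⟩
  by_contra hne
  rw [map_prod] at ha
  refine Finset.prod_ne_zero_iff.mp ha (e, f) (Finset.mem_offDiag.mpr ⟨he, hf, hne⟩) ?_
  have h1 := congrArg (Nat.cast (R := ℤ)) hef
  push_cast at h1
  simp only [map_sum, map_mul, MvPolynomial.eval_C, MvPolynomial.eval_X, sub_mul,
    Finset.sum_sub_distrib, sub_eq_zero]
  simpa only [mul_comm] using h1

theorem aeval_X_pow_eq_zero {m : ℕ} {T : Finset (Fin m →₀ ℕ)} {a : Fin m → ℕ}
    (ha : Set.InjOn (fun e : Fin m →₀ ℕ => ∑ i, a i * e i) T) {P : MvPolynomial (Fin m) K}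
    (hP : P.support ⊆ T)
    (h : MvPolynomial.aeval (fun i => (Polynomial.X ^ a i : Polynomial K)) P = 0) : P = 0 := by
  by_contra hP0
  obtain ⟨e, he⟩ := MvPolynomial.support_nonempty.mpr hP0
  have h1 := congrArg (fun p => Polynomial.coeff p (∑ i, a i * e i)) h
  simp only [MvPolynomial.aeval_def, MvPolynomial.eval₂_eq', Polynomial.finsetSum_coeff,
    Polynomial.coeff_zero, Polynomial.algebraMap_eq, Polynomial.coeff_C_mul, ← pow_mul,
    Finset.prod_pow_eq_pow_sum, Polynomial.coeff_X_pow] at h1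
  rw [Finset.sum_eq_single_of_mem e he] at h1
  · simp only [if_true, mul_one] at h1
    exact MvPolynomial.mem_support_iff.mp he h1
  · intro f hf hfe
    rw [if_neg, mul_zero]
    exact fun h => hfe (ha (hP hf) (hP he) h.symm)

open scoped IntermediateField.algebraAdjoinAdjoin in
/-- A finitely generated subfield of `K(V)` of transcendence degree at most one embeds in the
field of rational functions in one variable. -/
theorem exists_algHom_ratFunc {m : ℕ} {ι : Type*} [Finite ι] (f : ι → FunctionField K m)
    (htr : Algebra.trdeg K (IntermediateField.adjoin K (Set.range f)) ≤ 1) :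
    Nonempty (IntermediateField.adjoin K (Set.range f) →ₐ[K] RatFunc K) := by
  classical
  have := Fintype.ofFinite ι
  obtain ⟨q, p, hq, hp⟩ := exists_common_denominator f
  obtain ⟨a, ha⟩ := exists_injOn_weight (q.support ∪ Finset.univ.biUnion fun i => (p i).support)
  -- Restriction to a monomial curve, which works even for finite `K`. The weights keep all
  -- monomials of `q` and the `p i` apart, so no `K`-linear relation between these polynomials is
  -- created.
  let w : Fin m → RatFunc K := fun i => algebraMap (Polynomial K) _ (Polynomial.X ^ a i)
  have hw : ∀ P : MvPolynomial (Fin m) K, MvPolynomial.aeval w P = algebraMap (Polynomial K) _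
      (MvPolynomial.aeval (fun i => (Polynomial.X ^ a i : Polynomial K)) P) := fun P =>
    (MvPolynomial.comp_aeval_apply _ (IsScalarTower.toAlgHom K (Polynomial K) (RatFunc K)) P).symm
  have hw0 : ∀ P : MvPolynomial (Fin m) K,
      P.support ⊆ q.support ∪ Finset.univ.biUnion (fun i => (p i).support) →
      MvPolynomial.aeval w P = 0 → P = 0 := fun P hP h => by
    rw [hw, FaithfulSMul.algebraMap_eq_zero_iff] at h
    exact aeval_X_pow_eq_zero ha hP h
  have hwq : MvPolynomial.aeval w q ≠ 0 := fun h => hq (hw0 q Finset.subset_union_left h)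
  obtain ⟨r, ψ, φ, hψ, hr, hr'⟩ := exists_specialization hq hp w hwq
  have hdom : IsDomain (Localization.Away q) := hψ.isDomain
  let R := Algebra.adjoin K (Set.range r)
  have hRmap : R.map ψ = Algebra.adjoin K (Set.range f) := by
    rw [hr, Set.range_comp, AlgHom.map_adjoin]
  let e : R ≃ₐ[K] Algebra.adjoin K (Set.range f) :=
    (R.equivMapOfInjective ψ hψ).trans (Subalgebra.equivOfEq _ _ hRmap)
  have hinj : Function.Injective (φ.comp R.val) := by
    refine injective_of_trdeg_le_one ?_ _
      (r := fun i => (⟨r i, Algebra.subset_adjoin ⟨i, rfl⟩⟩ : R)) ?_ ?_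
    · rwa [e.trdeg_eq, ← trdeg_adjoin]
    · rw [eq_top_iff]
      rintro ⟨x, hx⟩ -
      have h1 : (Algebra.adjoin K (Set.range fun i =>
          (⟨r i, Algebra.subset_adjoin ⟨i, rfl⟩⟩ : R))).map R.val = R := by
        rw [AlgHom.map_adjoin, ← Set.range_comp]
        rfl
      have h2 : x ∈ (Algebra.adjoin K (Set.range fun i =>
          (⟨r i, Algebra.subset_adjoin ⟨i, rfl⟩⟩ : R))).map R.val := h1.symm ▸ hx
      obtain ⟨y, hy, rfl⟩ := h2
      exact hy
    · intro i hi
      have hφi : φ (r i) = MvPolynomial.aeval w (p i) / MvPolynomial.aeval w q :=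
        (congrFun hr' i).symm
      refine RatFunc.transcendental_of_ne_C _ ?_
      rintro ⟨c, hc⟩
      change φ (r i) = _ at hc
      rw [hφi, div_eq_iff hwq, ← RatFunc.algebraMap_eq_C] at hc
      -- If `f i` became a constant `c` on the curve, then `p i = c q` already, so `f i = c` was
      -- constant. Thus a transcendental generator has transcendental image.
      have h1 : p i - MvPolynomial.C c * q = 0 := by
        refine hw0 _ ?_ ?_
        · refine (MvPolynomial.support_sub _ _ _).trans (Finset.union_subset ?_ ?_)
          · exact (Finset.subset_biUnion_of_mem (fun i => (p i).support)
              (Finset.mem_univ i)).trans Finset.subset_union_right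
          · rw [← MvPolynomial.smul_eq_C_mul]
            exact MvPolynomial.support_smul.trans Finset.subset_union_left
        · rw [map_sub, map_mul, hc, MvPolynomial.aeval_C, sub_self]
      have h2 : f i = algebraMap K _ c := by
        have hq' : algebraMap _ (FunctionField K m) q ≠ 0 := by
          rwa [Ne, FaithfulSMul.algebraMap_eq_zero_iff]
        refine mul_right_cancel₀ hq' ?_
        rw [hp, sub_eq_zero.mp h1, map_mul]
        rfl
      have h3 : r i = algebraMap K _ c := hψ (by
        rw [← Function.comp_apply (f := ψ), ← hr, h2, AlgHom.commutes])
      refine hi ?_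
      have h4 : (⟨r i, Algebra.subset_adjoin ⟨i, rfl⟩⟩ : R) = algebraMap K R c := Subtype.ext h3
      rw [h4]
      exact isAlgebraic_algebraMap c
  have hinj' : Function.Injective ((φ.comp R.val).comp
      (e.symm : Algebra.adjoin K (Set.range f) →ₐ[K] R)) := hinj.comp e.symm.injective
  exact ⟨IsFractionRing.liftAlgHom hinj'⟩

end CurveSpecialization

/-! ### Automorphisms of `K(X)`. -/

section RationalFunctionField

variable {K : Type u} [Field K]

/-- An automorphism of `K(X)` over `K` is a Möbius transformation. -/
theorem exists_moebius (τ : RatFunc K ≃ₐ[K] RatFunc K) : ∃ a b c d : K,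
    RatFunc.C c * RatFunc.X + RatFunc.C d ≠ 0 ∧
    τ RatFunc.X * (RatFunc.C c * RatFunc.X + RatFunc.C d) =
      RatFunc.C a * RatFunc.X + RatFunc.C b := by
  set f := τ RatFunc.X with hf
  have htop : IntermediateField.adjoin K {f} = ⊤ := by
    have h1 := congrArg (IntermediateField.map (τ : RatFunc K →ₐ[K] RatFunc K))
      (RatFunc.adjoin_X (K := K))
    rw [IntermediateField.adjoin_map, Set.image_singleton, ← AlgHom.fieldRange_eq_map] at h1
    rw [hf]
    exact h1.trans (AlgHom.fieldRange_eq_top.mpr τ.surjective)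
  -- `[K(X) : K(f)]` is the larger degree of numerator and denominator, here `1`.
  have h1 := f.finrank_eq_max_natDegree
  rw [htop, IntermediateField.finrank_top] at h1
  obtain ⟨a, b, hab⟩ := Polynomial.exists_eq_X_add_C_of_natDegree_le_one
    ((le_max_left _ _).trans h1.ge)
  obtain ⟨c, d, hcd⟩ := Polynomial.exists_eq_X_add_C_of_natDegree_le_one
    ((le_max_right _ _).trans h1.ge)
  have hnum : algebraMap _ (RatFunc K) f.num = RatFunc.C a * RatFunc.X + RatFunc.C b := by
    rw [hab]; simp
  have hden : algebraMap _ (RatFunc K) f.denom = RatFunc.C c * RatFunc.X + RatFunc.C d := by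
    rw [hcd]; simp
  have hden0 : algebraMap _ (RatFunc K) f.denom ≠ 0 :=
    RatFunc.algebraMap_ne_zero f.denom_ne_zero
  refine ⟨a, b, c, d, hden ▸ hden0, ?_⟩
  rw [← hden, ← hnum, ← div_eq_iff_mul_eq hden0]
  exact f.num_div_denom

theorem ratFunc_algEquiv_ext {τ : RatFunc K ≃ₐ[K] RatFunc K} (h : τ RatFunc.X = RatFunc.X) :
    τ = 1 := by
  have h1 : (τ : RatFunc K →ₐ[K] RatFunc K) = AlgHom.id K _ := by
    refine IsLocalization.algHom_ext (W := nonZeroDivisors (Polynomial K))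
      (A := Polynomial K) ?_
    refine Polynomial.algHom_ext ?_
    change τ (algebraMap (Polynomial K) _ Polynomial.X) = algebraMap (Polynomial K) _ Polynomial.X
    rwa [RatFunc.algebraMap_X]
  exact AlgEquiv.ext fun x => DFunLike.congr_fun h1 x

theorem quadratic_coeff_eq_zero {p q s : K}
    (h : RatFunc.C p * RatFunc.X ^ 2 + RatFunc.C q * RatFunc.X + RatFunc.C s = 0) : q = 0 := by
  have h1 : algebraMap (Polynomial K) (RatFunc K)
      (Polynomial.C p * Polynomial.X ^ 2 + Polynomial.C q * Polynomial.X + Polynomial.C s) = 0 := by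
    simpa using h
  rw [FaithfulSMul.algebraMap_eq_zero_iff] at h1
  simpa [Polynomial.coeff_X, Polynomial.coeff_X_pow] using
    congrArg (fun p => Polynomial.coeff p 1) h1

/-- In characteristic two, `PGL_2(K)` has no element of order four. -/
theorem sq_eq_one_of_pow_four_eq_one [CharP K 2] {τ : RatFunc K ≃ₐ[K] RatFunc K}
    (hτ : τ ^ 4 = 1) : τ ^ 2 = 1 := by
  obtain ⟨a, b, c, d, hne, h1⟩ := exists_moebius τ
  set A := RatFunc.C a
  set B := RatFunc.C b
  set C := RatFunc.C c
  set D := RatFunc.C d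
  set X : RatFunc K := RatFunc.X
  have step : ∀ σ : RatFunc K ≃ₐ[K] RatFunc K,
      C * σ X + D ≠ 0 ∧ σ (τ X) * (C * σ X + D) = A * σ X + B := by
    intro σ
    have hCσ : ∀ k : K, σ (RatFunc.C k) = RatFunc.C k := fun k => σ.commutes k
    have h2 := (map_ne_zero σ).mpr hne
    have h3 := congrArg σ h1
    simp only [map_add, map_mul, hCσ, A, B, C, D] at h2 h3
    exact ⟨h2, h3⟩
  -- The coefficients are the entries of the squared matrix `M²`, where `M` has rows `(a, b)` and
  -- `(c, d)`.
  have hsq : ∀ σ : RatFunc K ≃ₐ[K] RatFunc K, (C * (A + D)) * σ X + (B * C + D ^ 2) ≠ 0 ∧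
      σ (τ (τ X)) * ((C * (A + D)) * σ X + (B * C + D ^ 2)) =
        (A ^ 2 + B * C) * σ X + B * (A + D) := by
    intro σ
    obtain ⟨h2, h3⟩ := step σ
    obtain ⟨h4, h5⟩ := step (σ * τ)
    simp only [AlgEquiv.mul_apply] at h4 h5
    have h6 : (C * (A + D)) * σ X + (B * C + D ^ 2) =
        (C * σ (τ X) + D) * (C * σ X + D) := by
      linear_combination (-C) * h3
    rw [h6]
    refine ⟨mul_ne_zero h4 h2, ?_⟩
    linear_combination (C * σ X + D) * h5 + A * h3
  obtain ⟨h2, h3⟩ := hsq 1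
  obtain ⟨h4, h5⟩ := hsq (τ ^ 2)
  have h6 : (τ ^ 2) (τ (τ X)) = X := by
    have : (τ ^ 4) X = X := by rw [hτ]; rfl
    exact this
  have h7 : (τ ^ 2) X = τ (τ X) := rfl
  rw [h6, h7] at h5
  simp only [AlgEquiv.one_apply] at h2 h3
  have htwo : (2 : RatFunc K) = 0 := by
    have : RatFunc.C (2 : K) = 2 := map_ofNat _ 2
    rw [← this, CharTwo.two_eq_zero, map_zero]
  -- `τ⁴ X = X` is a quadratic relation for `X` whose middle coefficient is, in characteristic two,
  -- the fourth power of the trace of `M`. Once the trace vanishes, Cayley–Hamilton makes `M²`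
  -- scalar.
  have hquad : (d + a) ^ 4 = 0 := by
    refine quadratic_coeff_eq_zero (p := (c * (a + d)) * (a + d) ^ 2)
      (s := (b * (a + d)) * (a + d) ^ 2) ?_
    simp only [map_mul, map_add, map_pow]
    change C * (A + D) * (A + D) ^ 2 * X ^ 2 + (D + A) ^ 4 * X + B * (A + D) * (A + D) ^ 2 = 0
    linear_combination (C * (A + D) * X + (B * C + D ^ 2)) * h5 -
      (X * C * (A + D) - (A ^ 2 + B * C)) * h3 +
      (C * (A + D) * (A * D - B * C) * X ^ 2 + (A ^ 4 + 2 * A ^ 3 * D + 3 * A ^ 2 * D ^ 2 +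
        2 * A * D ^ 3 + B * C * (A ^ 2 - D ^ 2)) * X +
        B * (A + D) * (A ^ 2 + D ^ 2 + A * D + B * C)) * htwo
  have hda : D + A = 0 := by
    have := pow_eq_zero_iff (n := 4) (by norm_num) |>.mp hquad
    have h := congrArg (RatFunc.C (K := K)) this
    simpa using h
  have hAD : A = D := by linear_combination hda - D * htwo
  refine ratFunc_algEquiv_ext ?_
  change τ (τ X) = X
  rw [hAD] at h2 h3
  refine mul_right_cancel₀ h2 ?_
  linear_combination h3 + (B * D - C * D * X ^ 2) * htwo

end RationalFunctionField

/-! ### Lower bounds from the one-variable function field. -/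

section LowerBounds

variable {K : Type u} [Field K] {m : ℕ} {G : Type w} [Group G]

/-- The automorphism of a compression induced by a group element. -/
def IsCompression.restrict {L : Type v} [Field L] [Algebra K L] {α : G →* (L ≃ₐ[K] L)}
    {E : IntermediateField K L} (hE : IsCompression α E) (g : G) : E ≃ₐ[K] E :=
  AlgEquiv.ofAlgHom
    (((α g : L →ₐ[K] L).comp E.val).codRestrict E.toSubalgebra fun x => hE.map_mem g x x.2)
    (((α g⁻¹ : L →ₐ[K] L).comp E.val).codRestrict E.toSubalgebra fun x => hE.map_mem g⁻¹ x x.2)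
    (AlgHom.ext fun x => Subtype.ext (by
      change α g (α g⁻¹ (x : L)) = x
      rw [← AlgEquiv.mul_apply, ← map_mul, mul_inv_cancel, map_one, AlgEquiv.one_apply]))
    (AlgHom.ext fun x => Subtype.ext (by
      change α g⁻¹ (α g (x : L)) = x
      rw [← AlgEquiv.mul_apply, ← map_mul, inv_mul_cancel, map_one, AlgEquiv.one_apply]))

theorem IsCompression.coe_restrict {L : Type v} [Field L] [Algebra K L] {α : G →* (L ≃ₐ[K] L)}
    {E : IntermediateField K L} (hE : IsCompression α E) (g : G) (x : E) :
    (hE.restrict g x : L) = α g x := rfl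

/-- A compression of transcendence degree at most one contains a compression that embeds in the
field of rational functions in one variable. -/
theorem IsCompression.exists_algHom_ratFunc [Finite G] {ρ : G →* GL (Fin m) K}
    {E : IntermediateField K (FunctionField K m)} (hE : IsCompression (functionFieldAction ρ) E)
    (htr : Algebra.trdeg K E ≤ 1) : ∃ E' ≤ E, IsCompression (functionFieldAction ρ) E' ∧
      Nonempty (E' →ₐ[K] RatFunc K) := by
  obtain ⟨f, hfE, hf, hf'⟩ := hE.exists_family
  have hle : IntermediateField.adjoin K (Set.range f) ≤ E := by
    rw [IntermediateField.adjoin_le_iff]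
    rintro _ ⟨i, rfl⟩
    exact hfE i
  exact ⟨_, hle, isCompression_adjoin_family hf hf',
    EssentialDimension.exists_algHom_ratFunc f ((trdeg_le_of_le hle).trans htr)⟩

theorem IsCompression.ne_bot [Nontrivial G] {L : Type v} [Field L] [Algebra K L]
    {α : G →* (L ≃ₐ[K] L)} {E : IntermediateField K L} (hE : IsCompression α E) : E ≠ ⊥ := by
  rintro rfl
  obtain ⟨g, hg⟩ := exists_ne (1 : G)
  obtain ⟨x, hx, hx'⟩ := hE.faithful g hg
  obtain ⟨c, rfl⟩ := IntermediateField.mem_bot.mp hx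
  exact hx' ((α g).commutes c)

theorem fieldRange_ne_bot {F : Type*} [Field F] [Algebra K F] {L : Type v} [Field L] [Algebra K L]
    {E : IntermediateField K L} (hE : E ≠ ⊥) (j : E →ₐ[K] F) : j.fieldRange ≠ ⊥ := by
  intro h
  refine hE (le_bot_iff.mp fun x hx => ?_)
  have h1 : j ⟨x, hx⟩ ∈ (⊥ : IntermediateField K F) := h ▸ ⟨_, rfl⟩
  obtain ⟨c, hc⟩ := IntermediateField.mem_bot.mp h1
  rw [← j.commutes] at hc
  exact IntermediateField.mem_bot.mpr ⟨c, congrArg Subtype.val (j.injective hc)⟩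

/-- `K` is algebraically closed in `K(X)`, so an algebraic compression embedded there would be `K`,
on which `G` acts trivially. -/
theorem IsCompression.one_le_trdeg [Finite G] [Nontrivial G] {ρ : G →* GL (Fin m) K}
    {E : IntermediateField K (FunctionField K m)}
    (hE : IsCompression (functionFieldAction ρ) E) : 1 ≤ Algebra.trdeg K E := by
  rw [Cardinal.one_le_iff_ne_zero]
  intro h0
  obtain ⟨E', hle, hE', ⟨j⟩⟩ := hE.exists_algHom_ratFunc (h0.trans_le zero_le_one)
  have : FaithfulSMul K E' :=
    (faithfulSMul_iff_algebraMap_injective _ _).mpr (algebraMap K E').injective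
  have halg := (trdeg_eq_zero_iff (R := K) (A := E')).mp
    (le_bot_iff.mp ((trdeg_le_of_le hle).trans h0.le))
  refine fieldRange_ne_bot hE'.ne_bot j (le_bot_iff.mp ?_)
  rintro _ ⟨x, rfl⟩
  by_contra hx
  have h1 : Transcendental K (j x) := RatFunc.transcendental_of_ne_C _ fun ⟨c, hc⟩ =>
    hx (IntermediateField.mem_bot.mpr ⟨c, hc.symm⟩)
  exact h1 ((halg.isAlgebraic x).algHom j)

theorem IsCompression.two_le_trdeg [CharP K 2] [Finite G] {g : G} (hg4 : g ^ 4 = 1)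
    (hg2 : g ^ 2 ≠ 1) {ρ : G →* GL (Fin m) K} {E : IntermediateField K (FunctionField K m)}
    (hE : IsCompression (functionFieldAction ρ) E) : 2 ≤ Algebra.trdeg K E := by
  by_contra hlt
  have hlt' : Algebra.trdeg K E ≤ 1 := by
    rw [not_le] at hlt
    obtain ⟨n, hn⟩ := Cardinal.lt_aleph0.mp (hlt.trans Cardinal.ofNat_lt_aleph0)
    rw [hn] at hlt ⊢
    exact_mod_cast Nat.lt_succ_iff.mp (by exact_mod_cast hlt)
  obtain ⟨E', -, hE', ⟨j⟩⟩ := hE.exists_algHom_ratFunc hlt'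
  have : Nontrivial G := ⟨g ^ 2, 1, hg2⟩
  have hj := fieldRange_ne_bot hE'.ne_bot j
  -- Lüroth: the image of `E'` in `K(X)` is not `K`, so it is purely transcendental, and `g` becomes
  -- an automorphism of `K(X)`.
  let e : E' ≃ₐ[K] RatFunc K :=
    (AlgEquiv.ofInjectiveField j).trans (RatFunc.Luroth.algEquiv hj).symm
  let τ : RatFunc K ≃ₐ[K] RatFunc K := e.symm.trans ((hE'.restrict g).trans e)
  have hτ : ∀ x, τ (e x) = e (hE'.restrict g x) := fun x => by simp [τ]
  have hτn : ∀ (n : ℕ) x, (τ ^ n) (e x) = e (hE'.restrict (g ^ n) x) := by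
    intro n
    induction n with
    | zero =>
      intro x
      rw [pow_zero, pow_zero, AlgEquiv.one_apply]
      congr 1
      ext
      rw [hE'.coe_restrict, map_one, AlgEquiv.one_apply]
    | succ n ih =>
      intro x
      rw [pow_succ, AlgEquiv.mul_apply, hτ, ih, pow_succ]
      congr 1
      ext
      simp only [hE'.coe_restrict, map_mul, AlgEquiv.mul_apply]
  have h4 : τ ^ 4 = 1 := by
    ext1 y
    obtain ⟨x, rfl⟩ := e.surjective y
    rw [hτn, hg4, AlgEquiv.one_apply]
    congr 1
    ext
    rw [hE'.coe_restrict, map_one, AlgEquiv.one_apply]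
  obtain ⟨x, hx, hx'⟩ := hE'.faithful _ hg2
  have h5 := hτn 2 ⟨x, hx⟩
  rw [sq_eq_one_of_pow_four_eq_one h4, AlgEquiv.one_apply] at h5
  exact hx' (congrArg Subtype.val (e.injective h5)).symm

end LowerBounds

/-! ### Independence of the representation, and symmetric groups. -/

section SymmetricGroups

variable {K : Type u} [Field K]

theorem infinite_functionField {m : ℕ} (hm : m ≠ 0) : Infinite (FunctionField K m) := by
  have : Nonempty (Fin m) := ⟨⟨0, Nat.pos_of_ne_zero hm⟩⟩
  exact Infinite.of_injective _ (FaithfulSMul.algebraMap_injective (MvPolynomial (Fin m) K) _)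

/-- The essential dimension can be bounded above with the help of any representation. -/
theorem edExt_invariantField_le {G : Type w} [Group G] [Finite G] [Nontrivial G] {m n : ℕ}
    {ρ : G →* GL (Fin m) K} (hρ : Function.Injective ρ) {ρ' : G →* GL (Fin n) K}
    {E : IntermediateField K (FunctionField K n)} (hE : IsCompression (functionFieldAction ρ') E) :
    edExt (invariantField ρ) ≤ Algebra.trdeg K E := by
  -- Versality needs `K(V)` infinite even when `K` is finite, so `V` must be nonzero.
  have hm : m ≠ 0 := by
    rintro rfl
    obtain ⟨g, hg⟩ := exists_ne (1 : G)
    exact hg (hρ (Subsingleton.elim _ _))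
  have := infinite_functionField (K := K) hm
  exact (edExt_le_iff (functionFieldAction_injective hρ)).mpr
    (hE.specialize (functionFieldAction_injective hρ))

theorem edExt_invariantField_eq {G : Type w} [Group G] [Finite G] [Nontrivial G] {m n : ℕ}
    {ρ : G →* GL (Fin m) K} (hρ : Function.Injective ρ) {ρ' : G →* GL (Fin n) K}
    (hρ' : Function.Injective ρ') : edExt (invariantField ρ) = edExt (invariantField ρ') := by
  refine le_antisymm ?_ ?_
  · exact (le_edExt_iff (functionFieldAction_injective hρ')).mpr
      fun E hE => edExt_invariantField_le hρ hE
  · exact (le_edExt_iff (functionFieldAction_injective hρ)).mpr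
      fun E hE => edExt_invariantField_le hρ' hE

theorem exists_isEssDim_perm {n d : ℕ} (hn : 2 ≤ n)
    (h : ∃ E, IsCompression (functionFieldAction (permRep K n)) E ∧ Algebra.trdeg K E ≤ d) :
    ∃ e, IsEssDim K (Equiv.Perm (Fin n)) e ∧ e ≤ d := by
  have : Nontrivial (Fin n) := Fin.nontrivial_iff_two_le.mpr hn
  have hle : edExt (invariantField (permRep K n)) ≤ d :=
    (edExt_le_iff (functionFieldAction_injective (permRep_injective K n))).mpr h
  obtain ⟨e, he⟩ := Cardinal.lt_aleph0.mp (hle.trans_lt (Cardinal.natCast_lt_aleph0))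
  refine ⟨e, ⟨⟨n, permRep K n, permRep_injective K n⟩, fun m ρ hρ => ?_⟩, ?_⟩
  · rw [← he]
    exact edExt_invariantField_eq hρ (permRep_injective K n)
  · rw [he] at hle
    exact_mod_cast hle

theorem isEssDim_perm {n d : ℕ} (hn : 2 ≤ n)
    (h : ∃ E, IsCompression (functionFieldAction (permRep K n)) E ∧ Algebra.trdeg K E ≤ d)
    (h' : ∀ E, IsCompression (functionFieldAction (permRep K n)) E →
      (d : Cardinal) ≤ Algebra.trdeg K E) :
    IsEssDim K (Equiv.Perm (Fin n)) d := by
  obtain ⟨e, he, hed⟩ := exists_isEssDim_perm hn h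
  have h1 := (le_edExt_iff (functionFieldAction_injective (permRep_injective K n))).mpr h'
  have h2 := he.2 n (permRep K n) (permRep_injective K n)
  change (d : Cardinal) ≤ edExt (invariantField (permRep K n)) at h1
  rw [h2] at h1
  have h3 : d ≤ e := by exact_mod_cast h1
  rwa [le_antisymm h3 hed]

theorem exists_perm_order_four {n : ℕ} (hn : 4 ≤ n) :
    ∃ g : Equiv.Perm (Fin n), g ^ 4 = 1 ∧ g ^ 2 ≠ 1 := by
  let ι := Equiv.Perm.viaEmbeddingHom (Fin.castLEEmb hn)
  have hι : Function.Injective ι := Equiv.Perm.viaEmbeddingHom_injective _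
  have h4 : finRotate 4 ^ 4 = 1 := by decide
  have h2 : finRotate 4 ^ 2 ≠ 1 := by decide
  refine ⟨ι (finRotate 4), by rw [← map_pow, h4, map_one], fun h => h2 (hι ?_)⟩
  rw [map_pow, h, map_one]

theorem two_le_trdeg_of_isCompression_permRep {n : ℕ} (hn : 4 ≤ n)
    {E : IntermediateField K (FunctionField K n)}
    (hE : IsCompression (functionFieldAction (permRep K n)) E) :
    ((2 : ℕ) : Cardinal) ≤ Algebra.trdeg K E := by
  by_cases hK : ringChar K = 2
  · have : CharP K 2 := hK ▸ ringChar.charP K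
    obtain ⟨g, hg4, hg2⟩ := exists_perm_order_four hn
    exact_mod_cast hE.two_le_trdeg hg4 hg2
  · exact hE.le_trdeg_of_two_mul_le hK hn

theorem one_le_trdeg_of_isCompression_permRep {n : ℕ} (hn : 2 ≤ n)
    {E : IntermediateField K (FunctionField K n)}
    (hE : IsCompression (functionFieldAction (permRep K n)) E) :
    ((1 : ℕ) : Cardinal) ≤ Algebra.trdeg K E := by
  have : Nontrivial (Fin n) := Fin.nontrivial_iff_two_le.mpr hn
  exact_mod_cast hE.one_le_trdeg

end SymmetricGroups

end EssentialDimension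

end

theorem theorem1p2 (K : Type*) [Field K] :
    (∀ n : ℕ, 5 ≤ n →
      ∃ d : ℕ, EssentialDimension.IsEssDim K (Equiv.Perm (Fin n)) d ∧ d ≤ n - 3) ∧
    (EssentialDimension.IsEssDim K (Equiv.Perm (Fin 2)) 1 ∧
      EssentialDimension.IsEssDim K (Equiv.Perm (Fin 3)) 1 ∧
      EssentialDimension.IsEssDim K (Equiv.Perm (Fin 4)) 2 ∧
      EssentialDimension.IsEssDim K (Equiv.Perm (Fin 5)) 2) ∧
    (ringChar K ≠ 2 → EssentialDimension.IsEssDim K (Equiv.Perm (Fin 6)) 3) := by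
  open EssentialDimension in
  refine ⟨fun n hn => ?_, ⟨?_, ?_, ?_, ?_⟩, fun hK => ?_⟩
  · obtain ⟨k, rfl⟩ := Nat.exists_eq_add_of_le' (show 3 ≤ n by omega)
    exact exists_isEssDim_perm (by omega) (exists_compression_cross_ratio K (by omega))
  · exact isEssDim_perm le_rfl (exists_compression_ratio K 1)
      fun E hE => one_le_trdeg_of_isCompression_permRep le_rfl hE
  · exact isEssDim_perm (by omega) (exists_compression_difference_ratio K le_rfl)
      fun E hE => one_le_trdeg_of_isCompression_permRep (by omega) hE
  -- Cross-ratios are not faithful for `S_4`; the affine invariants already give the sharp bound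
  -- `2`.
  · exact isEssDim_perm (by omega) (exists_compression_difference_ratio K one_le_two)
      fun E hE => two_le_trdeg_of_isCompression_permRep le_rfl hE
  · exact isEssDim_perm (by omega) (exists_compression_cross_ratio K le_rfl)
      fun E hE => two_le_trdeg_of_isCompression_permRep (by omega) hE
  · exact isEssDim_perm (by omega) (exists_compression_cross_ratio K (by omega))
      fun E hE => hE.le_trdeg_of_two_mul_le hK (by omega)
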